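/- **Theorem (Suboptimal stability of accelerated randomized Kaczmarz).** There are universal constants $c,K>0$ and universal polynomials $C,C_1,D$, positive on the nonnegative integers, such that the following holds. Let $n\ge 1$, let $A\in\mathbb R^{n\times n}$ be invertible with rows $a_1^\top,\dots,a_n^\top$, let $b\in\mathbb R^n$ and $x=A^{-1}b$. Write $\|\cdot\|$ for the Euclidean norm and the induced operator norm, $\|\cdot\|_F$ for the Frobenius norm, $\tilde\kappa=\|A\|_F\|A^{-1}\|$, and $\sigma_{\min}$ for the smallest singular value of $A$. Assume that either 1. $\lambda=\|A\|_F^2/n$, or 2. $\lambda=0$ and $\max_i\|a_i\|^2\le 4\min_i\|a_i\|^2$. Set $$\tilde\mu=\frac{\sigma_{\min}^2}{\|A\|_F^2+n\lambda},\qquad \tilde\nu=\frac{\|A\|_F^2+n\lambda}{\min_i\|a_i\|^2+\lambda},\qquad \beta=1-\sqrt{\tilde\mu/\tilde\nu},\quad \gamma=\frac1{\sqrt{\tilde\mu\tilde\nu}},\quad \alpha=\frac1{1+\gamma\tilde\nu}.$$ Regularized accelerated randomized Kaczmarz (ARK) starts from $v_0=y_0=0$ and, for $k=0,1,2,\dots$,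 computes $x_k=\alpha v_k+(1-\alpha)y_k$, draws a row index $r(k)$, independently of the earlier draws, with probability proportional to $\|a_{r(k)}\|^2+\lambda$, and sets $$w_k=\frac{\langle a_{r(k)},x_k\rangle-b_{r(k)}}{\|a_{r(k)}\|^2+\lambda}\,a_{r(k)},\qquad y_{k+1}=x_k-w_k,\qquad v_{k+1}=\beta v_k+(1-\beta)x_k-\gamma w_k .$$ Let $u>0$ satisfy $\tilde\kappa^2u\le 1/D(n)$, and let $\hat x_0,\hat x_1,\dots$ be the iterates $x_k$ when ARK is executed in floating-point arithmetic with unit roundoff $u$ in the standard model: the inputs $A,b,\lambda,\tilde\mu,\tilde\nu$ are rounded once, the scalars $\alpha,\beta,\gamma,1-\alpha,1-\beta$ are computed from the rounded $\tilde\mu,\tilde\nu$, the row indices are drawn with the exact probabilities, and each rounding of an input and each result of an operation $+,-,\times,\div,\sqrt{\cdot}$ has relative error at most $u$, where the errors may depend on the rows drawn up to that point but not on rows drawn later. Then for every $k\ge 0$ $$\mathbb E\|\hat x_k-x\|\le\Bigl(1-\frac1{4\tilde\kappa\sqrt n}\Bigr)^{k/4}c\,\|x\|+C(n)\,\|x\|\,\tilde\kappa^2u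 .$$ In particular, for every $k\ge K\,\tilde\kappa\sqrt n\,\log(1/u)$, $$\mathbb E\|\hat x_k-x\|\le C_1(n)\,\|x\|\,\tilde\kappa^2u .$$ -/

import Mathlib

open MeasureTheory ProbabilityTheory
open scoped Matrix

noncomputable section

/-! ### Matrix quantities -/

/-- The squared Euclidean norm of the `i`-th row of `A`. -/
def rowSq {n : ℕ} (A : Matrix (Fin n) (Fin n) ℝ) (i : Fin n) : ℝ := ∑ j, A i j ^ 2

/-- The Frobenius norm. -/
def frobNorm {n : ℕ} (A : Matrix (Fin n) (Fin n) ℝ) : ℝ := Real.sqrt (∑ i, ∑ j, A i j ^ 2)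

/-- The Demmel condition number: Frobenius norm of `A` times spectral norm of the inverse. -/
def demmelCond {n : ℕ} (A : Matrix (Fin n) (Fin n) ℝ) : ℝ :=
  frobNorm A * ‖Matrix.toEuclideanCLM (n := Fin n) (𝕜 := ℝ) A⁻¹‖

/-- The smallest of the `n` singular values (Mathlib lists them in decreasing order from `0`). -/
def sigmaMin {n : ℕ} (A : Matrix (Fin n) (Fin n) ℝ) : ℝ :=
  (Matrix.toEuclideanLin (𝕜 := ℝ) A).singularValues (n - 1)

/-- The acceleration parameter `μ̃`. -/
def arkMu {n : ℕ} (A : Matrix (Fin n) (Fin n) ℝ) (lam : ℝ) : ℝ :=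
  sigmaMin A ^ 2 / (frobNorm A ^ 2 + n * lam)

/-- The acceleration parameter `ν̃`. -/
def arkNu {n : ℕ} (A : Matrix (Fin n) (Fin n) ℝ) (lam : ℝ) : ℝ :=
  (frobNorm A ^ 2 + n * lam) / ((⨅ i, rowSq A i) + lam)

/-! ### The standard model of floating-point arithmetic

There is no fixed rounding function: every rounded quantity may be any real number within the
permitted relative error. In particular any deterministic rounding map with unit roundoff `u` is
covered. -/

/-- `xh` is an admissible floating-point result for the exact value `x` at unit roundoff `u`. -/
def FlRound (u x xh : ℝ) : Prop := |xh - x| ≤ u * |x|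

/-- `FlSum u f s c`: the value `c` can result from summing the numbers `f i`, `i ∈ s`, with
rounded additions (in an arbitrary order and bracketing). -/
inductive FlSum {ι : Type} [DecidableEq ι] (u : ℝ) (f : ι → ℝ) : Finset ι → ℝ → Prop
  | single (i : ι) : FlSum u f {i} (f i)
  | add {s t : Finset ι} {a b c : ℝ} : Disjoint s t → FlSum u f s a → FlSum u f t b →
      FlRound u (a + b) c → FlSum u f (s ∪ t) c

/-- `d` can result from computing the inner product of `a` and `x` in floating point. -/
def FlDot {n : ℕ} (u : ℝ) (a x : Fin n → ℝ) (d : ℝ) : Prop :=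
  ∃ p : Fin n → ℝ, (∀ j, FlRound u (a j * x j) (p j)) ∧ FlSum u p Finset.univ d

/-- `c` can result from computing `α * s + α' * t` in floating point. -/
def FlComb (u α α' s t c : ℝ) : Prop :=
  ∃ p q : ℝ, FlRound u (α * s) p ∧ FlRound u (α' * t) q ∧ FlRound u (p + q) c

/-- `w` can result from computing `((⟨a, x⟩ - b) / (‖a‖² + lam)) • a` in floating point. -/
def FlProj {n : ℕ} (u : ℝ) (a : Fin n → ℝ) (b lam : ℝ) (x w : Fin n → ℝ) : Prop :=
  ∃ d num sq den c : ℝ,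
    FlDot u a x d ∧ FlRound u (d - b) num ∧
    FlDot u a a sq ∧ FlRound u (sq + lam) den ∧
    FlRound u (num / den) c ∧ ∀ j, FlRound u (c * a j) (w j)

/-- The computed scalars `α = 1 / (1 + γ ν)`, `β = 1 - √(μ / ν)`, `γ = 1 / √(μ ν)`, together
with `α' = 1 - α` and `β' = 1 - β`, all evaluated in floating point from `μ` and `ν`. -/
structure FlArkParams (u μ ν : ℝ) where
  (μ' ν' ratio ratioRoot prod prodRoot gn gn1 α α' β β' γ : ℝ)
  round_mu : FlRound u μ μ'
  round_nu : FlRound u ν ν'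
  round_ratio : FlRound u (μ' / ν') ratio
  round_ratioRoot : FlRound u (Real.sqrt ratio) ratioRoot
  round_beta : FlRound u (1 - ratioRoot) β
  round_beta' : FlRound u (1 - β) β'
  round_prod : FlRound u (μ' * ν') prod
  round_prodRoot : FlRound u (Real.sqrt prod) prodRoot
  round_gamma : FlRound u (1 / prodRoot) γ
  round_gn : FlRound u (γ * ν') gn
  round_gn1 : FlRound u (1 + gn) gn1
  round_alpha : FlRound u (1 / gn1) α
  round_alpha' : FlRound u (1 - α) α'

/-- A floating-point execution, at unit roundoff `u`, of regularized accelerated randomized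
Kaczmarz for the system `A x = b` with parameters `lam`, `μ`, `ν`, started from zero.
Each iterate is a function of the list of the row indices drawn so far (latest draw first), so
rounding errors may depend on the past in any way, but not on rows that are drawn later. -/
structure FlArk {n : ℕ} (u : ℝ) (A : Matrix (Fin n) (Fin n) ℝ) (b : Fin n → ℝ)
    (lam μ ν : ℝ) where
  /-- the stored (rounded) matrix -/
  A' : Matrix (Fin n) (Fin n) ℝ
  /-- the stored (rounded) right-hand side -/
  b' : Fin n → ℝ
  /-- the stored (rounded) regularization parameter -/
  lam' : ℝ
  par : FlArkParams u μ ν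
  /-- the iterates of the algorithm -/
  (x y v : List (Fin n) → EuclideanSpace ℝ (Fin n))
  /-- the computed update directions: `w h i` is used when row `i` is drawn after history `h` -/
  w : List (Fin n) → Fin n → EuclideanSpace ℝ (Fin n)
  round_A : ∀ i j, FlRound u (A i j) (A' i j)
  round_b : ∀ i, FlRound u (b i) (b' i)
  round_lam : FlRound u lam lam'
  v_nil : v [] = 0
  y_nil : y [] = 0
  /-- `x_k = α v_k + (1 - α) y_k` -/
  step_x : ∀ h j, FlComb u par.α par.α' (v h j) (y h j) (x h j)
  /-- `w_k = ((⟨a_i, x_k⟩ - b_i) / (‖a_i‖² + lam)) a_i` -/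
  step_w : ∀ h i, FlProj u (A' i) (b' i) lam' (fun j => x h j) (fun j => w h i j)
  /-- `y_{k+1} = x_k - w_k` -/
  step_y : ∀ h i j, FlRound u (x h j - w h i j) (y (i :: h) j)
  /-- `v_{k+1} = β v_k + (1 - β) x_k - γ w_k` -/
  step_v : ∀ h i j, ∃ m g : ℝ, FlComb u par.β par.β' (v h j) (x h j) m ∧
    FlRound u (par.γ * w h i j) g ∧ FlRound u (m - g) (v (i :: h) j)

/-! ### The random rows -/

/-- `r 0, r 1, …` are independent random row indices, row `i` having probability proportional
to `‖a_i‖² + lam`. -/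
structure IsArkSampling {n : ℕ} {Ω : Type*} [MeasurableSpace Ω] (A : Matrix (Fin n) (Fin n) ℝ)
    (lam : ℝ) (P : Measure Ω) (r : ℕ → Ω → Fin n) : Prop where
  measurable : ∀ k, Measurable (r k)
  indep : iIndepFun r P
  law : ∀ k i, P (r k ⁻¹' {i}) =
    ENNReal.ofReal ((rowSq A i + lam) / ∑ l, (rowSq A l + lam))

/-- The rows drawn in the first `k` iterations, latest first. -/
def drawn {n : ℕ} {Ω : Type*} (r : ℕ → Ω → Fin n) : ℕ → Ω → List (Fin n)
  | 0, _ => []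
  | k + 1, ω => r k ω :: drawn r k ω

end

/-! The proof perturbs a Lyapunov argument. Let `v`, `y` stand for the errors of the iterates, and
put s = √μ̃, t = √ν̃, ρ = s/t, S = ‖A‖_F² + nλ, κ = `demmelCond A`. The potential is Φ = S‖A⁻ᵀv‖² +
‖y‖²/μ̃.

Exact step: A⁻ᵀ sends row i to the basis vector eᵢ, so the cross term produced by the `v`-update
averages to a multiple of ⟨Ax, A⁻ᵀp⟩ = ⟨x, p⟩, where p = (1-ρ)v + ρx. Its quadratic term is paid for
by the decrease of ‖y‖². The expectation of Φ shrinks by 1 - ρ (`sum_arkLyapunov_step_le`).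

Rounded step: Φ controls ‖v‖ by √Φ and ‖y‖ by s√Φ. With M = √Φ + ‖x‖/s, where x is now the solution,
one computed step deviates from the exact one by O(n²uM) in `v` and O(n²u·sM) in `y`
(`FlArk.step_perturbation`). Since S‖A⁻ᵀz‖² ≤ ‖z‖²/μ̃, the deviation has potential at most ε²M² with
ε of order n²u/s. A weighted Young inequality turns this into E Φ' ≤ (1 - ρ/2)Φ + O(ε²/ρ)(‖x‖/s)² as
long as ε is small against ρ (`FlArk.sum_lyapunov_le`).

Iterating, E Φ decays geometrically from at most 2(‖x‖/s)² to a floor of order (ε/ρ)²(‖x‖/s)².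
Jensen's inequality and the bound of the error of `x_k` by a multiple of s√Φ, up to O(nu)‖x‖, leave
a floor of order (ε/ρ)‖x‖. Both parameter regimes give ν̃ ≤ 4n, 1/μ̃ ≤ 2κ² and ρ ≥ 1/(2κ√n), so that
ε/ρ, of order n²ut/s², is O(n³κ²u). -/

/-! ### Propagation of relative errors and the computed scalars -/

theorem FlRound.mono {u u' a b : ℝ} (h : FlRound u a b) (hu : u ≤ u') : FlRound u' a b :=
  le_trans h (mul_le_mul_of_nonneg_right hu (abs_nonneg a))

theorem FlRound.abs_le_mul {u a b : ℝ} (h : FlRound u a b) : |b| ≤ (1 + u) * |a| := by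
  have h1 : |b| ≤ |b - a| + |a| := by simpa using abs_add_le (b - a) a
  have h2 : |b - a| ≤ u * |a| := h
  linarith

theorem FlRound.trans {u u' a b c : ℝ} (hu' : 0 ≤ u') (hab : FlRound u a b)
    (hbc : FlRound u' b c) : FlRound (u + u' + u * u') a c := by
  have h1 : |c - a| ≤ |c - b| + |b - a| := abs_sub_le c b a
  have h2 : |c - b| ≤ u' * |b| := hbc
  have h3 : |b - a| ≤ u * |a| := hab
  have h4 := mul_le_mul_of_nonneg_left hab.abs_le_mul hu'
  unfold FlRound
  nlinarith

theorem FlRound.mul {u u' a a' b b' : ℝ} (hu : 0 ≤ u) (ha : FlRound u a a')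
    (hb : FlRound u' b b') : FlRound (u + u' + u * u') (a * b) (a' * b') := by
  have e : a' * b' - a * b = (a' - a) * b + a' * (b' - b) := by ring
  have h1 : |a' * b' - a * b| ≤ |a' - a| * |b| + |a'| * |b' - b| := by
    rw [e, ← abs_mul, ← abs_mul]; exact abs_add_le _ _
  have h2 := mul_le_mul_of_nonneg_right ha (abs_nonneg b)
  have h3 := mul_le_mul ha.abs_le_mul hb (abs_nonneg _) (by positivity)
  unfold FlRound
  rw [abs_mul]
  nlinarith

theorem FlRound.inv {u a a' : ℝ} (hu : u ≤ 1 / 2) (h : FlRound u a a') :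
    FlRound (2 * u) a⁻¹ a'⁻¹ := by
  have h0 : |a' - a| ≤ u * |a| := h
  rcases eq_or_ne a 0 with rfl | ha
  · have : a' = 0 := by simpa using h0
    simp [FlRound, this]
  have hp : 0 < |a| := abs_pos.2 ha
  have h1 : |a| ≤ |a' - a| + |a'| := by
    have := abs_add_le (a - a') a'
    rwa [abs_sub_comm a a', sub_add_cancel] at this
  have h2 : |a| / 2 ≤ |a'| := by nlinarith
  have hp' : 0 < |a'| := by linarith
  have ha' : a' ≠ 0 := abs_pos.1 hp'
  have hu0 : 0 ≤ u := by
    by_contra hneg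
    have := mul_neg_of_neg_of_pos (not_le.1 hneg) hp
    linarith [abs_nonneg (a' - a)]
  have e : a'⁻¹ - a⁻¹ = -((a' - a) * (a'⁻¹ * a⁻¹)) := by field_simp; ring
  unfold FlRound
  rw [e, abs_neg, abs_mul, abs_mul, abs_inv, abs_inv]
  have h3 : |a'|⁻¹ ≤ 2 * |a|⁻¹ := by
    rw [inv_le_comm₀ hp' (by positivity)]
    simpa [mul_inv, div_eq_mul_inv, mul_comm] using h2
  calc |a' - a| * (|a'|⁻¹ * |a|⁻¹) ≤ (u * |a|) * (2 * |a|⁻¹ * |a|⁻¹) := by gcongr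
    _ = 2 * u * |a|⁻¹ := by field_simp

theorem FlRound.sqrt {u a a' : ℝ} (ha : 0 ≤ a) (hu1 : u ≤ 1) (h : FlRound u a a') :
    FlRound u (√a) (√a') := by
  have h0 : |a' - a| ≤ u * |a| := h
  rcases ha.eq_or_lt with rfl | hpos
  · have : a' = 0 := by simpa using h0
    simp [FlRound, this]
  rw [abs_of_pos hpos] at h0
  have ha' : 0 ≤ a' := by
    have := (abs_le.1 h0).1
    nlinarith
  have hs := Real.sqrt_pos.2 hpos
  have hs' := Real.sqrt_nonneg a'
  have e : (√a' - √a) * (√a' + √a) = a' - a := by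
    ring_nf; rw [Real.sq_sqrt ha, Real.sq_sqrt ha']
  have h1 : |√a' - √a| * (√a' + √a) = |a' - a| := by
    rw [← e, abs_mul, abs_of_pos (by positivity : 0 < √a' + √a)]
  have h2 : |√a' - √a| * √a ≤ u * √a * √a := by
    rw [mul_assoc, Real.mul_self_sqrt ha]
    nlinarith [mul_nonneg (abs_nonneg (√a' - √a)) hs']
  unfold FlRound
  rw [abs_of_pos hs]
  exact le_of_mul_le_mul_right h2 hs

theorem FlRound.add_of_nonneg {u a a' b b' : ℝ} (ha : 0 ≤ a) (hb : 0 ≤ b) (h : FlRound u a a')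
    (h' : FlRound u b b') : FlRound u (a + b) (a' + b') := by
  unfold FlRound at *
  rw [abs_of_nonneg ha] at h
  rw [abs_of_nonneg hb] at h'
  rw [abs_of_nonneg (add_nonneg ha hb), add_sub_add_comm]
  linarith [abs_add_le (a' - a) (b' - b)]

theorem FlRound.refl {u : ℝ} (hu : 0 ≤ u) (a : ℝ) : FlRound u a a := by
  simpa [FlRound] using mul_nonneg hu (abs_nonneg a)

/-- The accuracy of the computed scalars: `α` and `γ` are computed with small relative error,
`1 - α`, `β` and `1 - β` with small absolute error. -/
theorem FlArkParams.error {u μ ν : ℝ} (hu : 0 < u) (hu1 : u ≤ 1 / 1000) (hμ : 0 < μ)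
    (hν : 0 < ν) (hle : μ ≤ ν) (p : FlArkParams u μ ν) :
    FlRound (50 * u) (1 / (1 + 1 / √(μ * ν) * ν)) p.α ∧
    |p.α' - (1 - 1 / (1 + 1 / √(μ * ν) * ν))| ≤ 50 * u ∧
    |p.β - (1 - √(μ / ν))| ≤ 50 * u ∧ |p.β' - √(μ / ν)| ≤ 50 * u ∧
    FlRound (50 * u) (1 / √(μ * ν)) p.γ := by
  have huu : u * u ≤ u / 1000 := by nlinarith
  have hratio : FlRound (6 * u) (μ / ν) p.ratio := by
    have h := ((p.round_mu.mul hu.le (p.round_nu.inv (by linarith))).mono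
      (u' := 4 * u) (by nlinarith))
    rw [← div_eq_mul_inv, ← div_eq_mul_inv] at h
    exact (h.trans hu.le p.round_ratio).mono (by nlinarith)
  have hroot : FlRound (8 * u) (√(μ / ν)) p.ratioRoot :=
    ((hratio.sqrt (by positivity) (by linarith)).trans hu.le p.round_ratioRoot).mono
      (by nlinarith)
  have hρ0 : 0 ≤ √(μ / ν) := Real.sqrt_nonneg _
  have hρ1 : √(μ / ν) ≤ 1 := by
    exact Real.sqrt_le_one.2 ((div_le_one hν).2 hle)
  have hprod : FlRound (5 * u) (μ * ν) p.prod :=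
    ((p.round_mu.mul hu.le p.round_nu).trans hu.le p.round_prod).mono (by nlinarith)
  have hprodRoot : FlRound (7 * u) (√(μ * ν)) p.prodRoot :=
    ((hprod.sqrt (by positivity) (by linarith)).trans hu.le p.round_prodRoot).mono
      (by nlinarith)
  have hγ : FlRound (16 * u) (1 / √(μ * ν)) p.γ := by
    have h := hprodRoot.inv (by linarith)
    have h' := p.round_gamma
    rw [one_div] at h' ⊢
    exact (h.trans hu.le h').mono (by nlinarith)
  have hgn : FlRound (20 * u) (1 / √(μ * ν) * ν) p.gn :=
    ((hγ.mul (by linarith) p.round_nu).trans hu.le p.round_gn).mono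
      (by nlinarith [mul_pos hu (mul_pos hu hu)])
  have hgn1 : FlRound (22 * u) (1 + 1 / √(μ * ν) * ν) p.gn1 :=
    (((FlRound.refl (by linarith) 1).add_of_nonneg zero_le_one (by positivity) hgn).trans hu.le
      p.round_gn1).mono (by nlinarith)
  have hα : FlRound (46 * u) (1 / (1 + 1 / √(μ * ν) * ν)) p.α := by
    have h := hgn1.inv (by linarith)
    have h' := p.round_alpha
    rw [one_div] at h'
    rw [one_div (1 + _)]
    exact (h.trans hu.le h').mono (by nlinarith)
  have hα0 : 0 < 1 / (1 + 1 / √(μ * ν) * ν) := by positivity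
  have hα1 : 1 / (1 + 1 / √(μ * ν) * ν) ≤ 1 := by
    rw [div_le_one (by positivity)]
    have : 0 ≤ 1 / √(μ * ν) * ν := by positivity
    linarith
  refine ⟨hα.mono (by linarith), ?_, ?_, ?_, hγ.mono (by linarith)⟩
  · have h1 := p.round_alpha'
    have h2 := hα
    unfold FlRound at h1 h2
    rw [abs_of_pos hα0] at h2
    set a := 1 / (1 + 1 / √(μ * ν) * ν)
    rw [abs_le] at *
    rcases abs_cases (1 - p.α) with ⟨h3, _⟩ | ⟨h3, _⟩ <;> rw [h3] at h1 <;>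
      constructor <;> nlinarith
  all_goals
    have h1 := p.round_beta
    have h2 := hroot
    have h4 := p.round_beta'
    unfold FlRound at h1 h2 h4
    rw [abs_of_nonneg hρ0] at h2
    set s := √(μ / ν)
    have h5 : |p.ratioRoot - s| ≤ 8 * u := by nlinarith
    have h6 : |1 - p.ratioRoot| ≤ 2 := by
      rw [abs_le] at *; constructor <;> linarith
    have h7 : |p.β - (1 - p.ratioRoot)| ≤ 2 * u := by nlinarith
    have h8 : |p.β - (1 - s)| ≤ 10 * u := by
      rw [abs_le] at *; constructor <;> linarith
  · linarith
  · have h9 : |1 - p.β| ≤ 2 := by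
      rw [abs_le] at *; constructor <;> linarith
    have h10 : |p.β' - (1 - p.β)| ≤ 2 * u := by nlinarith
    rw [abs_le] at *; constructor <;> linarith

/-- The weights `a`, `a'` serve two cases: `a = |α|` when the coefficient is relatively accurate, `a
= 1` when cancellation leaves only absolute accuracy. The first is essential for `α v`, because `v`
may exceed `y` by a factor 1/s that only the smallness of `α` compensates. -/
theorem FlComb.error {u α α' αh αh' a a' s t c : ℝ} (hu : 0 ≤ u) (hu1 : u ≤ 1 / 1000)
    (hα : |α| ≤ a) (hα' : |α'| ≤ a') (h : |αh - α| ≤ 50 * u * a)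
    (h' : |αh' - α'| ≤ 50 * u * a') (hc : FlComb u αh αh' s t c) :
    |c - (α * s + α' * t)| ≤ 60 * u * (a * |s| + a' * |t|) := by
  obtain ⟨p, q, hp, hq, hpq⟩ := hc
  have key : ∀ {α αh a s p : ℝ}, |α| ≤ a → |αh - α| ≤ 50 * u * a → FlRound u (αh * s) p →
      |p - α * s| ≤ 52 * u * (a * |s|) ∧ |p| ≤ 2 * (a * |s|) := by
    intro α αh a s p hα h hp
    have ha : 0 ≤ a := (abs_nonneg α).trans hα
    have hs := abs_nonneg s
    have has := mul_nonneg ha hs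
    have h1 : |αh * s - α * s| ≤ 50 * u * (a * |s|) := by
      rw [← sub_mul, abs_mul]; nlinarith
    have h2 : |α * s| ≤ a * |s| := by rw [abs_mul]; nlinarith
    have h3 : |αh * s| ≤ (1 + 50 * u) * (a * |s|) := by
      have := abs_add_le (αh * s - α * s) (α * s)
      rw [sub_add_cancel] at this
      linarith
    have h4 : |p - αh * s| ≤ u * |αh * s| := hp
    have h5 := abs_sub_le p (αh * s) (α * s)
    have h6 : |p - α * s| ≤ 52 * u * (a * |s|) := by
      have e1 := mul_le_mul_of_nonneg_left h3 hu
      have e2 : u * ((1 + 50 * u) * (a * |s|)) ≤ 2 * u * (a * |s|) := by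
        have : u * (1 + 50 * u) ≤ 2 * u := by nlinarith
        nlinarith
      linarith
    refine ⟨h6, ?_⟩
    have := abs_add_le (p - α * s) (α * s)
    rw [sub_add_cancel] at this
    nlinarith
  obtain ⟨h1, h2⟩ := key hα h hp
  obtain ⟨h3, h4⟩ := key hα' h' hq
  have h5 : |c - (p + q)| ≤ u * |p + q| := hpq
  have h6 := abs_add_le p q
  have h7 := mul_le_mul_of_nonneg_left h6 hu
  have h8 := mul_le_mul_of_nonneg_left h2 hu
  have h9 := mul_le_mul_of_nonneg_left h4 hu
  have e : c - (α * s + α' * t) = (c - (p + q)) + ((p - α * s) + (q - α' * t)) := by ring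
  have h10 := abs_add_le (c - (p + q)) ((p - α * s) + (q - α' * t))
  have h11 := abs_add_le (p - α * s) (q - α' * t)
  rw [e]
  have p1 : 0 ≤ u * (a * |s|) :=
    mul_nonneg hu (mul_nonneg ((abs_nonneg α).trans hα) (abs_nonneg s))
  have p2 : 0 ≤ u * (a' * |t|) :=
    mul_nonneg hu (mul_nonneg ((abs_nonneg α').trans hα') (abs_nonneg t))
  nlinarith

/-! ### Rounded sums, inner products and projections -/

theorem FlSum.nonempty {ι : Type} [DecidableEq ι] {u : ℝ} {f : ι → ℝ} {s : Finset ι} {c : ℝ}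
    (h : FlSum u f s c) : s.Nonempty := by
  induction h with
  | single i => exact Finset.singleton_nonempty i
  | add _ _ _ _ hs _ => exact hs.mono Finset.subset_union_left

/-- For any bracketing, a summand passes through fewer additions than there are summands. In the
induction both parts are nonempty, so each has at most `m = card - 1` elements and the last addition
contributes one more factor `1 + u`. -/
theorem FlSum.error {ι : Type} [DecidableEq ι] {u : ℝ} (hu : 0 ≤ u) {f : ι → ℝ} {s : Finset ι}
    {c : ℝ} (h : FlSum u f s c) :
    |c - ∑ i ∈ s, f i| ≤ ((1 + u) ^ s.card - 1) * ∑ i ∈ s, |f i| := by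
  induction h with
  | single i => simpa using mul_nonneg hu (abs_nonneg (f i))
  | @add s t a b c hst hs ht hc ihs iht =>
    have cs := hs.nonempty.card_pos
    have ct := ht.nonempty.card_pos
    rw [Finset.sum_union hst, Finset.sum_union hst, Finset.card_union_of_disjoint hst]
    set Ss := ∑ i ∈ s, |f i|
    set St := ∑ i ∈ t, |f i|
    have hSs : |∑ i ∈ s, f i| ≤ Ss := Finset.abs_sum_le_sum_abs _ _
    have hSt : |∑ i ∈ t, f i| ≤ St := Finset.abs_sum_le_sum_abs _ _
    have ps : 0 ≤ Ss := (abs_nonneg _).trans hSs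
    have pt : 0 ≤ St := (abs_nonneg _).trans hSt
    obtain ⟨m, hm⟩ : ∃ m, s.card + t.card = m + 1 := ⟨s.card + t.card - 1, by omega⟩
    have g1 : (1 + u) ^ s.card ≤ (1 + u) ^ m := pow_le_pow_right₀ (by linarith) (by omega)
    have g2 : (1 + u) ^ t.card ≤ (1 + u) ^ m := pow_le_pow_right₀ (by linarith) (by omega)
    have hG : 1 ≤ (1 + u) ^ m := one_le_pow₀ (by linarith)
    rw [hm, pow_succ]
    set G := (1 + u) ^ m
    have ihs' : |a - ∑ i ∈ s, f i| ≤ (G - 1) * Ss :=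
      ihs.trans (mul_le_mul_of_nonneg_right (by linarith) ps)
    have iht' : |b - ∑ i ∈ t, f i| ≤ (G - 1) * St :=
      iht.trans (mul_le_mul_of_nonneg_right (by linarith) pt)
    have h1 : |a + b - (∑ i ∈ s, f i + ∑ i ∈ t, f i)| ≤ (G - 1) * (Ss + St) := by
      rw [add_sub_add_comm]
      linarith [abs_add_le (a - ∑ i ∈ s, f i) (b - ∑ i ∈ t, f i)]
    have h2 : |a + b| ≤ G * (Ss + St) := by
      have e := abs_add_le (a + b - (∑ i ∈ s, f i + ∑ i ∈ t, f i))
        (∑ i ∈ s, f i + ∑ i ∈ t, f i)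
      rw [sub_add_cancel] at e
      linarith [abs_add_le (∑ i ∈ s, f i) (∑ i ∈ t, f i)]
    have h3 : |c - (a + b)| ≤ u * |a + b| := hc
    have h4 := abs_sub_le c (a + b) (∑ i ∈ s, f i + ∑ i ∈ t, f i)
    nlinarith [mul_le_mul_of_nonneg_left h2 hu]

theorem one_add_pow_sub_one_le {u : ℝ} {n : ℕ} (hu : 0 ≤ u) (h : n * u ≤ 1) :
    (1 + u) ^ n - 1 ≤ 2 * (n * u) := by
  have h1 : (1 + u) ^ n ≤ Real.exp (n * u) := by
    rw [Real.exp_nat_mul]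
    exact pow_le_pow_left₀ (by linarith) (by linarith [Real.add_one_le_exp u]) n
  have h2 := Real.abs_exp_sub_one_le (x := n * u) (by rw [abs_of_nonneg (by positivity)]; exact h)
  rw [abs_of_nonneg (by positivity : (0:ℝ) ≤ n * u)] at h2
  linarith [le_abs_self (Real.exp (n * u) - 1)]

theorem FlDot.error {n : ℕ} (hn : 1 ≤ n) {u : ℝ} (hu : 0 ≤ u) (hnu : n * u ≤ 1 / 1000)
    {a x : Fin n → ℝ} {d : ℝ} (h : FlDot u a x d) :
    |d - ∑ j, a j * x j| ≤ 4 * (n * u) * ∑ j, |a j * x j| := by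
  obtain ⟨p, hp, hs⟩ := h
  have hn' : (1 : ℝ) ≤ n := by exact_mod_cast hn
  have hun : u ≤ n * u := by nlinarith
  have h1 := hs.error hu
  rw [Finset.card_univ, Fintype.card_fin] at h1
  have h2 := one_add_pow_sub_one_le (n := n) hu (by linarith)
  have h3 : ∑ j, |p j| ≤ (1 + u) * ∑ j, |a j * x j| := by
    rw [Finset.mul_sum]; exact Finset.sum_le_sum fun j _ => (hp j).abs_le_mul
  have h4 : |∑ j, p j - ∑ j, a j * x j| ≤ u * ∑ j, |a j * x j| := by
    rw [← Finset.sum_sub_distrib, Finset.mul_sum]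
    exact (Finset.abs_sum_le_sum_abs _ _).trans (Finset.sum_le_sum fun j _ => hp j)
  have hS : 0 ≤ ∑ j, |a j * x j| := Finset.sum_nonneg fun j _ => abs_nonneg _
  have hP : 0 ≤ ∑ j, |p j| := Finset.sum_nonneg fun j _ => abs_nonneg _
  have h5 := abs_sub_le d (∑ j, p j) (∑ j, a j * x j)
  have h6 : ((1 + u) ^ n - 1) * ∑ j, |p j| ≤ 3 * (n * u) * ∑ j, |a j * x j| := by
    calc _ ≤ 2 * (n * u) * ((1 + u) * ∑ j, |a j * x j|) := by gcongr
      _ = (2 * (n * u) * (1 + u)) * ∑ j, |a j * x j| := by ring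
      _ ≤ _ := mul_le_mul_of_nonneg_right (by nlinarith) hS
  nlinarith


/-- The residual can cancel almost completely, so its error is measured against the sum of the
absolute values that enter it. -/
theorem FlDot.residual_error {n : ℕ} (hn : 1 ≤ n) {u : ℝ} (hu : 0 ≤ u)
    (hnu : n * u ≤ 1 / 1000) {a a' x : Fin n → ℝ} {b b' d num : ℝ}
    (ha : ∀ j, FlRound u (a j) (a' j)) (hb : FlRound u b b') (hd : FlDot u a' x d)
    (hnum : FlRound u (d - b') num) :
    |num - (∑ j, a j * x j - b)| ≤ 8 * (n * u) * (∑ j, |a j * x j| + |b|) := by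
  have hn' : (1 : ℝ) ≤ n := by exact_mod_cast hn
  have hun : u ≤ n * u := by nlinarith
  have e2 := hd.error hn hu hnu
  set ε := n * u
  have huε : u * ε ≤ ε / 1000 := by nlinarith
  set A1 := ∑ j, |a j * x j| with hA1
  have hA10 : 0 ≤ A1 := Finset.sum_nonneg fun _ _ => abs_nonneg _
  have hax : |∑ j, a j * x j| ≤ A1 := Finset.abs_sum_le_sum_abs _ _
  have e1 : ∀ j, FlRound u (a j * x j) (a' j * x j) := fun j => by
    simpa using (ha j).mul hu (FlRound.refl le_rfl (x j))
  have e3 : ∑ j, |a' j * x j| ≤ (1 + u) * A1 := by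
    rw [hA1, Finset.mul_sum]; exact Finset.sum_le_sum fun j _ => (e1 j).abs_le_mul
  have e4 : |∑ j, a' j * x j - ∑ j, a j * x j| ≤ u * A1 := by
    rw [← Finset.sum_sub_distrib, hA1, Finset.mul_sum]
    exact (Finset.abs_sum_le_sum_abs _ _).trans (Finset.sum_le_sum fun j _ => e1 j)
  generalize ∑ j, a j * x j = s at *
  generalize ∑ j, a' j * x j = s' at *
  have hb0 := abs_nonneg b
  have e5 : |d - s| ≤ 6 * ε * A1 := by
    have := abs_sub_le d s' s
    have e6 : 4 * ε * ∑ j, |a' j * x j| ≤ 4 * ε * ((1 + u) * A1) := by gcongr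
    have e7 : 4 * ε * ((1 + u) * A1) ≤ 5 * ε * A1 := by nlinarith
    nlinarith
  have e7 : |b' - b| ≤ u * |b| := hb
  have e8 : |d - b' - (s - b)| ≤ 6 * ε * (A1 + |b|) := by
    have e : d - b' - (s - b) = (d - s) - (b' - b) := by ring
    rw [e]
    have := abs_sub (d - s) (b' - b)
    nlinarith
  have e9 : |s - b| ≤ A1 + |b| := (abs_sub s b).trans (by linarith)
  have e10 : |d - b'| ≤ 2 * (A1 + |b|) := by
    have := abs_add_le (d - b' - (s - b)) (s - b)
    rw [sub_add_cancel] at this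
    nlinarith
  have e11 : |num - (d - b')| ≤ u * |d - b'| := hnum
  have e12 := abs_sub_le num (d - b') (s - b)
  have e13 := mul_le_mul_of_nonneg_left e10 hu
  nlinarith

/-- All summands are nonnegative, so nothing cancels and the error is relative. -/
theorem FlDot.self_error {n : ℕ} (hn : 1 ≤ n) {u : ℝ} (hu : 0 ≤ u)
    (hnu : n * u ≤ 1 / 1000) {a a' : Fin n → ℝ} {sq : ℝ}
    (ha : ∀ j, FlRound u (a j) (a' j)) (h : FlDot u a' a' sq) :
    FlRound (10 * (n * u)) (∑ j, a j ^ 2) sq := by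
  have hn' : (1 : ℝ) ≤ n := by exact_mod_cast hn
  have hun : u ≤ n * u := by nlinarith
  have e2 := h.error hn hu hnu
  have e0 : ∑ j, |a' j * a' j| = ∑ j, a' j * a' j :=
    Finset.sum_congr rfl fun j _ => abs_of_nonneg (mul_self_nonneg _)
  have e1 : FlRound (4 * (n * u)) (∑ j, a' j * a' j) sq := by
    unfold FlRound
    rw [abs_of_nonneg (Finset.sum_nonneg fun j _ => mul_self_nonneg (a' j))]
    rwa [e0] at e2
  have e3 : FlRound (3 * u) (∑ j, a j ^ 2) (∑ j, a' j * a' j) := by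
    unfold FlRound
    rw [abs_of_nonneg (Finset.sum_nonneg fun j _ => sq_nonneg (a j)), ← Finset.sum_sub_distrib,
      Finset.mul_sum]
    refine (Finset.abs_sum_le_sum_abs _ _).trans (Finset.sum_le_sum fun j _ => ?_)
    have := ((ha j).mul hu (ha j)).mono (u' := 3 * u) (by nlinarith)
    unfold FlRound at this
    rwa [abs_mul_self, ← _root_.sq (a j)] at this
  exact (e3.trans (by positivity) e1).mono (by nlinarith)

/-- Error of a rounded quotient whose numerator has a small absolute error and whose denominator
has a small relative error. -/
theorem FlRound.quotient_error {u ε R den num num0 c m : ℝ} (hu : 0 ≤ u) (huε : u ≤ ε)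
    (hε : ε ≤ 1 / 1000) (hR : 0 < R) (hden : FlRound (12 * ε) R den)
    (hnum : |num - num0| ≤ 8 * ε * m) (hnum0 : |num0| ≤ m) (hc : FlRound u (num / den) c) :
    |c - num0 / R| ≤ 45 * ε * (m * R⁻¹) := by
  have hε0 : 0 ≤ ε := hu.trans huε
  have hm : 0 ≤ m := (abs_nonneg _).trans hnum0
  have hRi : 0 < R⁻¹ := by positivity
  have hinv : |den⁻¹ - R⁻¹| ≤ 24 * ε * R⁻¹ := by
    have := hden.inv (by linarith)
    unfold FlRound at this
    rw [abs_of_pos hRi] at this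
    linarith
  have hB0 : 0 ≤ m * R⁻¹ := by positivity
  have hεB := mul_nonneg hε0 hB0
  have hc1 : |num / den - num0 / R| ≤ 40 * ε * (m * R⁻¹) := by
    have e : num / den - num0 / R = (num - num0) * den⁻¹ + num0 * (den⁻¹ - R⁻¹) := by
      rw [div_eq_mul_inv, div_eq_mul_inv]; ring
    have e1 : |den⁻¹| ≤ 2 * R⁻¹ := by
      have := abs_add_le (den⁻¹ - R⁻¹) R⁻¹
      rw [sub_add_cancel, abs_of_pos hRi] at this
      nlinarith
    rw [e]
    refine (abs_add_le _ _).trans ?_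
    rw [abs_mul, abs_mul]
    calc _ ≤ 8 * ε * m * (2 * R⁻¹) + m * (24 * ε * R⁻¹) := by gcongr
      _ = _ := by ring
  have hc0 : |num0 / R| ≤ m * R⁻¹ := by
    rw [abs_div, abs_of_pos hR, div_eq_mul_inv]
    exact mul_le_mul_of_nonneg_right hnum0 hRi.le
  generalize m * R⁻¹ = B at *
  have hndB : |num / den| ≤ 2 * B := by
    have := abs_add_le (num / den - num0 / R) (num0 / R)
    rw [sub_add_cancel] at this
    nlinarith
  have e1 : |c - num / den| ≤ u * |num / den| := hc
  have e2 := abs_sub_le c (num / den) (num0 / R)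
  have e3 := mul_le_mul_of_nonneg_left hndB hu
  have e4 := mul_le_mul_of_nonneg_right huε hB0
  linarith

/-- The number `t` will be ‖x̂‖ + ‖x‖, for which `hx` is Cauchy–Schwarz. One row norm comes from the
residual and one from the final multiplication; the denominator, at least ‖a‖², absorbs both, so the
bound does not depend on the scale of the row. -/
theorem FlProj.error {n : ℕ} (hn : 1 ≤ n) {u : ℝ} (hu : 0 ≤ u) (hnu : n * u ≤ 1 / 1000)
    {a a' : Fin n → ℝ} {b b' lam lam' t : ℝ} {x w : Fin n → ℝ} (ha : ∀ j, FlRound u (a j) (a' j))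
    (hb : FlRound u b b') (hl : FlRound u lam lam') (hlam : 0 ≤ lam)
    (hR : 0 < ∑ j, a j ^ 2 + lam) (ht : 0 ≤ t)
    (hx : ∑ j, |a j * x j| + |b| ≤ √(∑ j, a j ^ 2) * t)
    (h : FlProj u a' b' lam' x w) (j : Fin n) :
    |w j - (∑ j, a j * x j - b) / (∑ j, a j ^ 2 + lam) * a j| ≤ 60 * (n * u) * t := by
  obtain ⟨d, num, sq, den, c, hd, hnum, hsq, hden, hc, hw⟩ := h
  have hn' : (1 : ℝ) ≤ n := by exact_mod_cast hn
  have hun : u ≤ n * u := by nlinarith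
  set ε := n * u with hε
  have hε0 : 0 ≤ ε := by positivity
  have huε : u * ε ≤ ε / 1000 := by nlinarith
  have hεε : ε * ε ≤ ε / 1000 := by nlinarith
  have huu : u * u ≤ u / 1000 := by nlinarith
  have hnumerr := hd.residual_error hn hu hnu ha hb hnum
  have hsqR := hsq.self_error hn hu hnu ha
  rw [← hε] at hnumerr hsqR
  set Q := ∑ j, a j ^ 2 with hQ
  have hQ0 : 0 ≤ Q := Finset.sum_nonneg fun _ _ => sq_nonneg _
  set r := √Q with hr
  have hr2 : r * r = Q := Real.mul_self_sqrt hQ0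
  have hr0 : 0 ≤ r := Real.sqrt_nonneg _
  set R := Q + lam with hRdef
  have haj : |a j| ≤ r := Real.abs_le_sqrt
    (Finset.single_le_sum (f := fun j => a j ^ 2) (fun _ _ => sq_nonneg _) (Finset.mem_univ j))
  set num0 := ∑ j, a j * x j - b with hnum0
  set A1 := ∑ j, |a j * x j| with hA1
  have hA10 : 0 ≤ A1 := Finset.sum_nonneg fun _ _ => abs_nonneg _
  have hax : |∑ j, a j * x j| ≤ A1 := Finset.abs_sum_le_sum_abs _ _
  have hrt : 0 ≤ r * t := mul_nonneg hr0 ht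
  have hnum0' : |num0| ≤ r * t := by
    have := abs_sub (∑ j, a j * x j) b
    linarith
  replace hnumerr : |num - num0| ≤ 8 * ε * (r * t) := hnumerr.trans (by gcongr)
  have hdenR : FlRound (12 * ε) R den :=
    ((hsqR.add_of_nonneg hQ0 hlam (hl.mono (by linarith))).trans hu hden).mono (by nlinarith)
  have hcerr := FlRound.quotient_error hu hun hnu hR hdenR hnumerr hnum0' hc
  have hRi : 0 < R⁻¹ := by positivity
  have hB0 : 0 ≤ r * t * R⁻¹ := by positivity
  have hc0 : |num0 / R| ≤ r * t * R⁻¹ := by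
    rw [abs_div, abs_of_pos hR, div_eq_mul_inv]
    exact mul_le_mul_of_nonneg_right hnum0' hRi.le
  have hBa : r * t * R⁻¹ * |a j| ≤ t := by
    have h1 : r * |a j| ≤ R := by
      have := mul_le_mul_of_nonneg_left haj hr0
      linarith
    have h2 : (r * |a j|) * R⁻¹ ≤ 1 := by
      rw [← div_eq_mul_inv]; exact (div_le_one hR).2 h1
    calc _ = (r * |a j|) * R⁻¹ * t := by ring
      _ ≤ 1 * t := by gcongr
      _ = t := one_mul t
  have hwa : |w j - c * a j| ≤ 3 * u * |c * a j| := by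
    have h1 : FlRound u (c * a j) (c * a' j) := by
      simpa using (FlRound.refl le_rfl c).mul le_rfl (ha j)
    exact (h1.trans hu (hw j)).mono (u' := 3 * u) (by nlinarith)
  clear_value num0
  generalize r * t * R⁻¹ = B at *
  have hεB := mul_le_mul_of_nonneg_right hnu hB0
  have hcB : |c| ≤ 2 * B := by
    have := abs_add_le (c - num0 / R) (num0 / R)
    rw [sub_add_cancel] at this
    linarith
  have hfin := abs_sub_le (w j) (c * a j) (num0 / R * a j)
  rw [← sub_mul, abs_mul (c - num0 / R)] at hfin
  rw [abs_mul c] at hwa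
  have k1 : |c| * |a j| ≤ 2 * t := by
    linarith [mul_le_mul_of_nonneg_right hcB (abs_nonneg (a j))]
  have k2 : |c - num0 / R| * |a j| ≤ 45 * (ε * t) := by
    linarith [mul_le_mul_of_nonneg_right hcerr (abs_nonneg (a j)),
      mul_le_mul_of_nonneg_left hBa hε0]
  linarith [mul_le_mul_of_nonneg_left k1 hu, mul_nonneg hε0 ht, mul_le_mul_of_nonneg_right hun ht]

/-! ### Singular values and the inverse transpose -/

/-- In an orthonormal eigenbasis of T*T, ‖Tz‖² is a sum of squared coordinates weighted by the
eigenvalues, the least of which is the last squared singular value. -/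
theorem LinearMap.singularValues_mul_norm_le {E F : Type*} [NormedAddCommGroup E]
    [InnerProductSpace ℝ E] [FiniteDimensional ℝ E] [NormedAddCommGroup F] [InnerProductSpace ℝ F]
    [FiniteDimensional ℝ F] (T : E →ₗ[ℝ] F) {n : ℕ} (hn : Module.finrank ℝ E = n) (z : E) :
    T.singularValues (n - 1) * ‖z‖ ≤ ‖T z‖ := by
  rcases Nat.eq_zero_or_pos n with rfl | hpos
  · have : Subsingleton E := Module.finrank_zero_iff.1 hn
    simp [Subsingleton.elim z 0]
  have hS := T.isSymmetric_adjoint_comp_self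
  refine le_of_sq_le_sq (b := ‖T z‖) ?_ (norm_nonneg _)
  have h1 : ‖T z‖ ^ 2 = inner ℝ z ((LinearMap.adjoint T ∘ₗ T) z) := by
    rw [LinearMap.comp_apply, LinearMap.adjoint_inner_right, real_inner_self_eq_norm_sq]
  set e := hS.eigenvectorBasis hn
  have h2 : inner ℝ z ((LinearMap.adjoint T ∘ₗ T) z)
      = ∑ i, hS.eigenvalues hn i * (e.repr z i) ^ 2 := by
    rw [← e.repr.inner_map_map, PiLp.inner_apply]
    refine Finset.sum_congr rfl fun i _ => ?_
    rw [hS.eigenvectorBasis_apply_self_apply hn]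
    simp; ring
  have h3 : ‖z‖ ^ 2 = ∑ i, (e.repr z i) ^ 2 := by
    rw [← e.repr.norm_map, EuclideanSpace.norm_sq_eq]; simp
  rw [mul_pow, h1, h2, h3, Finset.mul_sum,
    T.sq_singularValues_of_lt hn (Nat.sub_lt hpos one_pos)]
  refine Finset.sum_le_sum fun i _ => mul_le_mul_of_nonneg_right ?_ (sq_nonneg _)
  exact hS.eigenvalues_antitone hn (Fin.mk_le_mk.2 (by omega) : i ≤ ⟨n - 1, _⟩)

theorem LinearMap.exists_norm_eq_singularValues {E F : Type*} [NormedAddCommGroup E]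
    [InnerProductSpace ℝ E] [FiniteDimensional ℝ E] [NormedAddCommGroup F] [InnerProductSpace ℝ F]
    [FiniteDimensional ℝ F] (T : E →ₗ[ℝ] F) {i : ℕ} (hi : i < Module.finrank ℝ E) :
    ∃ z : E, z ≠ 0 ∧ ‖T z‖ = T.singularValues i * ‖z‖ := by
  obtain ⟨z, hz⟩ := (T.hasEigenvalue_adjoint_comp_self_sq_singularValues hi).exists_hasEigenvector
  refine ⟨z, hz.2, ?_⟩
  have h1 : ‖T z‖ ^ 2 = inner ℝ z ((LinearMap.adjoint T ∘ₗ T) z) := by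
    rw [LinearMap.comp_apply, LinearMap.adjoint_inner_right, real_inner_self_eq_norm_sq]
  rw [hz.apply_eq_smul, inner_smul_right, real_inner_self_eq_norm_sq] at h1
  rw [← sq_eq_sq₀ (norm_nonneg _) (mul_nonneg (T.singularValues_nonneg i) (norm_nonneg _)), h1]
  simp [mul_pow]

section Matrix

variable {n : ℕ} {A : Matrix (Fin n) (Fin n) ℝ}

theorem sigmaMin_mul_norm_le (A : Matrix (Fin n) (Fin n) ℝ) (z : EuclideanSpace ℝ (Fin n)) :
    sigmaMin A * ‖z‖ ≤ ‖A.toEuclideanLin z‖ :=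
  LinearMap.singularValues_mul_norm_le _ (by simp) z

theorem toEuclideanLin_inv_apply (hA : IsUnit A) (z : EuclideanSpace ℝ (Fin n)) :
    A.toEuclideanLin (A⁻¹.toEuclideanLin z) = z := by
  simp [Matrix.toLpLin_apply, Matrix.mulVec_mulVec,
    Matrix.mul_nonsing_inv A ((Matrix.isUnit_iff_isUnit_det A).1 hA)]

theorem inv_toEuclideanLin_apply (hA : IsUnit A) (z : EuclideanSpace ℝ (Fin n)) :
    A⁻¹.toEuclideanLin (A.toEuclideanLin z) = z := by
  simp [Matrix.toLpLin_apply, Matrix.mulVec_mulVec,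
    Matrix.nonsing_inv_mul A ((Matrix.isUnit_iff_isUnit_det A).1 hA)]

/-- Apply A⁻¹ to the image of a vector on which A attains its smallest singular value. This half of
σ_min‖A⁻¹‖ = 1 suffices to bound the parameters by κ. -/
theorem one_le_sigmaMin_mul_norm_inv (hn : 1 ≤ n) (hA : IsUnit A) :
    1 ≤ sigmaMin A * ‖Matrix.toEuclideanCLM (n := Fin n) (𝕜 := ℝ) A⁻¹‖ := by
  obtain ⟨z, hz, h⟩ := LinearMap.exists_norm_eq_singularValues (A.toEuclideanLin) (i := n - 1)
    (by simp; omega)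
  have h1 := (Matrix.toEuclideanCLM (n := Fin n) (𝕜 := ℝ) A⁻¹).le_opNorm (A.toEuclideanLin z)
  have h2 : Matrix.toEuclideanCLM (n := Fin n) (𝕜 := ℝ) A⁻¹ (A.toEuclideanLin z) = z :=
    inv_toEuclideanLin_apply hA z
  rw [h2, h] at h1
  change _ ≤ _ * (sigmaMin A * ‖z‖) at h1
  have hz' : 0 < ‖z‖ := norm_pos_iff.2 hz
  refine le_of_mul_le_mul_right ?_ hz'
  linarith

theorem sigmaMin_pos (hn : 1 ≤ n) (hA : IsUnit A) : 0 < sigmaMin A := by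
  have h := one_le_sigmaMin_mul_norm_inv hn hA
  have h0 : 0 ≤ sigmaMin A := LinearMap.singularValues_nonneg _ _
  refine h0.lt_of_ne fun h1 => ?_
  rw [← h1, zero_mul] at h
  linarith

theorem rowSq_nonneg (A : Matrix (Fin n) (Fin n) ℝ) (i : Fin n) : 0 ≤ rowSq A i :=
  Finset.sum_nonneg fun _ _ => sq_nonneg _

theorem frobNorm_sq (A : Matrix (Fin n) (Fin n) ℝ) : frobNorm A ^ 2 = ∑ i, rowSq A i :=
  Real.sq_sqrt (Finset.sum_nonneg fun i _ => rowSq_nonneg A i)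

theorem frobNorm_nonneg (A : Matrix (Fin n) (Fin n) ℝ) : 0 ≤ frobNorm A := Real.sqrt_nonneg _

theorem abs_sum_row_mul_le (A : Matrix (Fin n) (Fin n) ℝ) (i : Fin n)
    (z : EuclideanSpace ℝ (Fin n)) : ∑ j, |A i j * z j| ≤ √(rowSq A i) * ‖z‖ := by
  have h := Real.sum_mul_le_sqrt_mul_sqrt Finset.univ (fun j => |A i j|) (fun j => |z j|)
  simp only [sq_abs, ← abs_mul] at h
  rw [EuclideanSpace.norm_eq]
  simpa [rowSq] using h

theorem toEuclideanLin_coord (A : Matrix (Fin n) (Fin n) ℝ) (z : EuclideanSpace ℝ (Fin n))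
    (i : Fin n) : A.toEuclideanLin z i = ∑ j, A i j * z j := by
  simp [Matrix.toLpLin_apply, Matrix.mulVec, dotProduct]

theorem norm_toEuclideanLin_le (A : Matrix (Fin n) (Fin n) ℝ) (z : EuclideanSpace ℝ (Fin n)) :
    ‖A.toEuclideanLin z‖ ≤ frobNorm A * ‖z‖ := by
  refine le_of_sq_le_sq (a := ‖A.toEuclideanLin z‖) ?_
    (mul_nonneg (frobNorm_nonneg A) (norm_nonneg z))
  rw [mul_pow, frobNorm_sq, EuclideanSpace.norm_sq_eq, Finset.sum_mul]
  refine Finset.sum_le_sum fun i _ => ?_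
  rw [toEuclideanLin_coord, Real.norm_eq_abs]
  have h := (Finset.abs_sum_le_sum_abs _ _).trans (abs_sum_row_mul_le A i z)
  calc _ ≤ (√(rowSq A i) * ‖z‖) ^ 2 := pow_le_pow_left₀ (abs_nonneg _) h 2
    _ = _ := by rw [mul_pow, Real.sq_sqrt (rowSq_nonneg A i)]

/-- The inverse of the transpose of `A` as a linear map. -/
noncomputable def invTranspose (A : Matrix (Fin n) (Fin n) ℝ) :
    EuclideanSpace ℝ (Fin n) →ₗ[ℝ] EuclideanSpace ℝ (Fin n) := (A⁻¹)ᵀ.toEuclideanLin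

theorem inner_toEuclideanLin_transpose (M : Matrix (Fin n) (Fin n) ℝ)
    (x y : EuclideanSpace ℝ (Fin n)) :
    inner ℝ x (Mᵀ.toEuclideanLin y) = inner ℝ (M.toEuclideanLin x) y := by
  have : Mᵀ = Mᴴ := by ext; simp
  rw [this, Matrix.toEuclideanLin_conjTranspose_eq_adjoint, LinearMap.adjoint_inner_right]

theorem inner_toEuclideanLin_invTranspose (hA : IsUnit A) (x p : EuclideanSpace ℝ (Fin n)) :
    inner ℝ (A.toEuclideanLin x) (invTranspose A p) = inner ℝ x p := by
  rw [invTranspose, inner_toEuclideanLin_transpose, inv_toEuclideanLin_apply hA]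

/-- This is why the potential measures `v` through A⁻ᵀ: an update along row i changes only the i-th
coordinate there. -/
theorem invTranspose_row (hA : IsUnit A) (i : Fin n) :
    invTranspose A (WithLp.toLp 2 (A i)) = EuclideanSpace.single i 1 := by
  have h : (A⁻¹)ᵀ *ᵥ A i = Pi.single i 1 := by
    have h1 : A i = Aᵀ *ᵥ Pi.single i 1 := by
      ext j; simp
    rw [h1, Matrix.mulVec_mulVec, ← Matrix.transpose_mul,
      Matrix.mul_nonsing_inv A ((Matrix.isUnit_iff_isUnit_det A).1 hA),
      Matrix.transpose_one, Matrix.one_mulVec]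
  rw [invTranspose, Matrix.toLpLin_toLp, Matrix.toLin'_apply, h]
  rfl

/-- Cauchy–Schwarz in ‖z‖² = ⟨Az, A⁻ᵀz⟩. -/
theorem norm_le_frobNorm_mul_norm_invTranspose (hA : IsUnit A) (z : EuclideanSpace ℝ (Fin n)) :
    ‖z‖ ≤ frobNorm A * ‖invTranspose A z‖ := by
  rcases eq_or_ne z 0 with rfl | hz
  · simp
  have h1 : ‖z‖ * ‖z‖ ≤ ‖z‖ * (frobNorm A * ‖invTranspose A z‖) := by
    rw [← real_inner_self_eq_norm_mul_norm, ← inner_toEuclideanLin_invTranspose hA]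
    calc _ ≤ ‖A.toEuclideanLin z‖ * ‖invTranspose A z‖ := real_inner_le_norm _ _
      _ ≤ frobNorm A * ‖z‖ * ‖invTranspose A z‖ := by
        gcongr; exact norm_toEuclideanLin_le A z
      _ = _ := by ring
  exact le_of_mul_le_mul_left h1 (norm_pos_iff.2 hz)

/-- With g = A⁻ᵀz, Cauchy–Schwarz in ‖g‖² = ⟨A⁻¹g, z⟩, together with σ_min‖A⁻¹g‖ ≤ ‖g‖. -/
theorem sigmaMin_mul_norm_invTranspose_le (hA : IsUnit A) (z : EuclideanSpace ℝ (Fin n)) :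
    sigmaMin A * ‖invTranspose A z‖ ≤ ‖z‖ := by
  rcases eq_or_ne (invTranspose A z) 0 with h0 | h0
  · simp [h0]
  have hp := norm_pos_iff.2 h0
  set g := invTranspose A z with hg
  have h1 : ‖g‖ * ‖g‖ ≤ ‖A⁻¹.toEuclideanLin g‖ * ‖z‖ := by
    rw [← real_inner_self_eq_norm_mul_norm]
    nth_rewrite 2 [hg]
    rw [invTranspose, inner_toEuclideanLin_transpose]
    exact real_inner_le_norm _ _
  have h2 := sigmaMin_mul_norm_le A (A⁻¹.toEuclideanLin g)
  rw [toEuclideanLin_inv_apply hA] at h2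
  have hs : 0 ≤ sigmaMin A := LinearMap.singularValues_nonneg _ _
  refine le_of_mul_le_mul_right ?_ hp
  calc _ = sigmaMin A * (‖g‖ * ‖g‖) := by ring
    _ ≤ sigmaMin A * (‖A⁻¹.toEuclideanLin g‖ * ‖z‖) := by gcongr
    _ = sigmaMin A * ‖A⁻¹.toEuclideanLin g‖ * ‖z‖ := by ring
    _ ≤ ‖g‖ * ‖z‖ := by gcongr
    _ = _ := mul_comm _ _

end Matrix

/-! ### The Lyapunov function and the exact step -/

/-- The update direction of regularized Kaczmarz for row `i`, at a point with error `x`. -/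
noncomputable def rowUpdate {n : ℕ} (A : Matrix (Fin n) (Fin n) ℝ) (lam : ℝ) (i : Fin n)
    (x : EuclideanSpace ℝ (Fin n)) : EuclideanSpace ℝ (Fin n) :=
  (A.toEuclideanLin x i / (rowSq A i + lam)) • WithLp.toLp 2 (A i)

/-- The Lyapunov function of accelerated randomized Kaczmarz. -/
noncomputable def arkLyapunov {n : ℕ} (A : Matrix (Fin n) (Fin n) ℝ) (S μ : ℝ)
    (v y : EuclideanSpace ℝ (Fin n)) : ℝ :=
  S * ‖invTranspose A v‖ ^ 2 + ‖y‖ ^ 2 / μ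

section

variable {n : ℕ} {A : Matrix (Fin n) (Fin n) ℝ}

theorem norm_row_sq (A : Matrix (Fin n) (Fin n) ℝ) (i : Fin n) :
    ‖(WithLp.toLp 2 (A i) : EuclideanSpace ℝ (Fin n))‖ ^ 2 = rowSq A i := by
  rw [EuclideanSpace.norm_sq_eq]; simp [rowSq]

theorem inner_row (A : Matrix (Fin n) (Fin n) ℝ) (i : Fin n) (x : EuclideanSpace ℝ (Fin n)) :
    inner ℝ x (WithLp.toLp 2 (A i)) = A.toEuclideanLin x i := by
  rw [toEuclideanLin_coord, PiLp.inner_apply]; simp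

theorem norm_rowUpdate_le {lam : ℝ} (hlam : 0 ≤ lam) (i : Fin n)
    (x : EuclideanSpace ℝ (Fin n)) : ‖rowUpdate A lam i x‖ ≤ ‖x‖ := by
  have hR : 0 ≤ rowSq A i + lam := add_nonneg (rowSq_nonneg A i) hlam
  have h1 : |A.toEuclideanLin x i| ≤ ‖x‖ * ‖(WithLp.toLp 2 (A i) : EuclideanSpace ℝ (Fin n))‖ := by
    rw [← inner_row]; exact abs_real_inner_le_norm _ _
  rw [rowUpdate, norm_smul, Real.norm_eq_abs, abs_div, abs_of_nonneg hR, div_mul_eq_mul_div]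
  refine div_le_of_le_mul₀ hR (norm_nonneg _) ?_
  calc _ ≤ ‖x‖ * ‖(WithLp.toLp 2 (A i) : EuclideanSpace ℝ (Fin n))‖ *
        ‖(WithLp.toLp 2 (A i) : EuclideanSpace ℝ (Fin n))‖ := by gcongr
    _ = ‖x‖ * rowSq A i := by rw [mul_assoc, ← sq, norm_row_sq]
    _ ≤ _ := by gcongr; linarith

theorem rowUpdate_add (lam : ℝ) (i : Fin n) (x y : EuclideanSpace ℝ (Fin n)) :
    rowUpdate A lam i (x + y) = rowUpdate A lam i x + rowUpdate A lam i y := by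
  rw [rowUpdate, map_add, PiLp.add_apply, add_div, add_smul]; rfl

theorem arkLyapunov_nonneg {S μ : ℝ} (hS : 0 ≤ S) (hμ : 0 ≤ μ)
    (v y : EuclideanSpace ℝ (Fin n)) : 0 ≤ arkLyapunov A S μ v y := by
  unfold arkLyapunov; positivity

theorem norm_add_sq_le {E : Type*} [NormedAddCommGroup E] {s : ℝ} (hs : 0 < s) (a b : E) :
    ‖a + b‖ ^ 2 ≤ (1 + s) * ‖a‖ ^ 2 + (1 + 1 / s) * ‖b‖ ^ 2 := by
  have h := pow_le_pow_left₀ (norm_nonneg _) (norm_add_le a b) 2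
  have h2 : 0 ≤ (s * ‖a‖ - ‖b‖) ^ 2 / s := by positivity
  have e : (s * ‖a‖ - ‖b‖) ^ 2 / s = s * ‖a‖ ^ 2 - 2 * ‖a‖ * ‖b‖ + 1 / s * ‖b‖ ^ 2 := by
    field_simp; ring
  nlinarith

theorem arkLyapunov_add_le {S μ s : ℝ} (hS : 0 ≤ S) (hμ : 0 ≤ μ) (hs : 0 < s)
    (v y dv dy : EuclideanSpace ℝ (Fin n)) :
    arkLyapunov A S μ (v + dv) (y + dy) ≤
      (1 + s) * arkLyapunov A S μ v y + (1 + 1 / s) * arkLyapunov A S μ dv dy := by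
  unfold arkLyapunov
  rw [map_add]
  have h1 := mul_le_mul_of_nonneg_left
    (norm_add_sq_le hs (invTranspose A v) (invTranspose A dv)) hS
  have h2 := div_le_div_of_nonneg_right (norm_add_sq_le hs y dy) hμ
  rw [add_div, mul_div_assoc, mul_div_assoc] at h2
  linarith

/-- One exact step of accelerated randomized Kaczmarz contracts the Lyapunov function by the
factor `1 - √(μ / ν)` in expectation. -/
theorem sum_arkLyapunov_step_le (hA : IsUnit A) {lam S m μ ν ρ γ : ℝ} (hm : 0 < m)
    (hmR : ∀ i, m ≤ rowSq A i + lam) (hS : S = ∑ i, (rowSq A i + lam)) (hS0 : 0 < S)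
    (hlam : 0 ≤ lam)
    (hμ : 0 < μ) (hρ : 0 < ρ) (hρ1 : ρ ≤ 1) (hν : ν = S / m)
    (hγν : γ * ν * ρ = 1) (hγμ : γ * μ = ρ)
    (hstar : ∀ z, S * ‖invTranspose A z‖ ^ 2 ≤ ‖z‖ ^ 2 / μ)
    {v y x : EuclideanSpace ℝ (Fin n)} (hx : (1 + ρ) • x = ρ • v + y) :
    ∑ i, (rowSq A i + lam) / S * arkLyapunov A S μ
        ((1 - ρ) • v + ρ • x - γ • rowUpdate A lam i x) (x - rowUpdate A lam i x) ≤
      (1 - ρ) * arkLyapunov A S μ v y := by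
  set P := (1 - ρ) • v + ρ • x with hP
  set B := invTranspose A with hB
  set T := A.toEuclideanLin with hT
  have hterm : ∀ i, (rowSq A i + lam) / S * arkLyapunov A S μ
        (P - γ • rowUpdate A lam i x) (x - rowUpdate A lam i x) ≤
      (rowSq A i + lam) / S * (S * ‖B P‖ ^ 2 + ‖x‖ ^ 2 / μ) - 2 * γ * (T x i * B P i) := by
    intro i
    have hR : 0 < rowSq A i + lam := hm.trans_le (hmR i)
    set c := T x i / (rowSq A i + lam) with hc
    have hTc : T x i = c * (rowSq A i + lam) := by rw [hc]; field_simp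
    have hU : rowUpdate A lam i x = c • WithLp.toLp 2 (A i) := rfl
    clear_value c
    have e1 : ‖B (P - γ • rowUpdate A lam i x)‖ ^ 2
        = ‖B P‖ ^ 2 - 2 * γ * c * B P i + γ ^ 2 * c ^ 2 := by
      rw [hU, map_sub, map_smul, map_smul, hB, invTranspose_row hA, norm_sub_sq_real,
        inner_smul_right, inner_smul_right, norm_smul, norm_smul]
      simp only [EuclideanSpace.inner_single_right, PiLp.norm_single, mul_pow, Real.norm_eq_abs,
        sq_abs]
      simp
      ring
    have e2 : ‖x - rowUpdate A lam i x‖ ^ 2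
        = ‖x‖ ^ 2 - 2 * c * T x i + c ^ 2 * rowSq A i := by
      rw [hU, norm_sub_sq_real, inner_smul_right, inner_row, norm_smul, mul_pow,
        norm_row_sq, Real.norm_eq_abs, sq_abs]
      ring
    rw [arkLyapunov, e1, e2, hTc]
    set R := rowSq A i + lam with hRd
    -- The choice of γ makes γ²Sμ equal to `m`, the smallest sampling weight. Hence the quadratic
    -- term of the `v`-part is at most the decrease c²R/μ of the `y`-part.
    have hγ2 : γ ^ 2 * S * μ ≤ R := by
      have h1 : S = ν * m := by rw [hν]; field_simp
      have h2 : γ ^ 2 * S * μ = m * (γ * ν * (γ * μ)) := by rw [h1]; ring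
      rw [h2, hγμ, hγν, mul_one]; exact hmR i
    have hrow : rowSq A i ≤ R := by linarith
    have h3 : S * (γ ^ 2 * c ^ 2) ≤ c ^ 2 * R / μ := by
      rw [le_div_iff₀ hμ]
      nlinarith [mul_le_mul_of_nonneg_left hγ2 (sq_nonneg c)]
    have h4 : (‖x‖ ^ 2 - 2 * c * (c * R) + c ^ 2 * rowSq A i) / μ
        ≤ ‖x‖ ^ 2 / μ - c ^ 2 * R / μ := by
      rw [← sub_div]
      refine div_le_div_of_nonneg_right ?_ hμ.le
      nlinarith [mul_le_mul_of_nonneg_left hrow (sq_nonneg c)]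
    have h5 : R / S * (S * (‖B P‖ ^ 2 - 2 * γ * c * B P i + γ ^ 2 * c ^ 2) +
        (‖x‖ ^ 2 - 2 * c * (c * R) + c ^ 2 * rowSq A i) / μ) ≤
        R / S * (S * ‖B P‖ ^ 2 + ‖x‖ ^ 2 / μ - S * (2 * γ * c * B P i)) :=
      mul_le_mul_of_nonneg_left (by linarith) (by positivity)
    -- The sampling weight R/S cancels the denominator in `c`, so the cross term becomes linear in
    -- the coordinates of Ax.
    refine h5.trans (le_of_eq ?_)
    field_simp
  refine (Finset.sum_le_sum fun i _ => hterm i).trans ?_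
  rw [Finset.sum_sub_distrib, ← Finset.sum_mul, ← Finset.sum_div, ← hS, div_self hS0.ne', one_mul,
    ← Finset.mul_sum]
  have hinner : ∑ i, T x i * B P i = inner ℝ x P := by
    rw [← inner_toEuclideanLin_invTranspose hA, PiLp.inner_apply]
    exact Finset.sum_congr rfl fun i _ => by simp [hB, hT, mul_comm]
  rw [hinner]
  have hconv : ‖B P‖ ^ 2 ≤ (1 - ρ) * ‖B v‖ ^ 2 + ρ * ‖B x‖ ^ 2 := by
    have h1 : ‖B P‖ ≤ (1 - ρ) * ‖B v‖ + ρ * ‖B x‖ := by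
      rw [hP, map_add, map_smul, map_smul]
      refine (norm_add_le _ _).trans ?_
      rw [norm_smul, norm_smul, Real.norm_of_nonneg hρ.le, Real.norm_of_nonneg (by linarith)]
    have h2 := pow_le_pow_left₀ (norm_nonneg _) h1 2
    nlinarith [mul_nonneg (mul_nonneg hρ.le (sub_nonneg.2 hρ1)) (sq_nonneg (‖B v‖ - ‖B x‖))]
  -- The coupling `hx` says that ρP = x - (1-ρ)y, which eliminates `v` from the inner product.
  have hxP : ρ * inner ℝ x P = ‖x‖ ^ 2 - (1 - ρ) * inner ℝ x y := by
    have h1 : ρ • P = x - (1 - ρ) • y := by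
      have h2 : ρ • P = (1 - ρ) • (ρ • v + y) - (1 - ρ) • y + (ρ * ρ) • x := by
        rw [hP]; module
      rw [h2, ← hx]; module
    rw [← inner_smul_right, h1, inner_sub_right, inner_smul_right, real_inner_self_eq_norm_sq]
  have hγ' : 2 * γ * inner ℝ x P = 2 * (‖x‖ ^ 2 - (1 - ρ) * inner ℝ x y) / μ := by
    rw [← hxP, eq_div_iff hμ.ne']
    linear_combination (2 * inner ℝ x P) * hγμ
  rw [hγ', arkLyapunov]
  have h6 := hstar x
  -- After the convexity bound and `hstar x`, what remains is (1-ρ)(2⟨x,y⟩ - ‖x‖²)/μ, at most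
  -- (1-ρ)‖y‖²/μ by this square.
  have h7 : 0 ≤ (1 - ρ) * ‖x - y‖ ^ 2 / μ := by
    have : 0 ≤ 1 - ρ := by linarith
    positivity
  rw [norm_sub_sq_real] at h7
  have h8 := mul_le_mul_of_nonneg_left hconv hS0.le
  have h9 := mul_le_mul_of_nonneg_left h6 hρ.le
  have h10 : (1 - ρ) * (‖x‖ ^ 2 - 2 * inner ℝ x y + ‖y‖ ^ 2) / μ
      = (1 - ρ) * (‖x‖ ^ 2 / μ) - 2 * ((1 - ρ) * inner ℝ x y) / μ + (1 - ρ) * (‖y‖ ^ 2 / μ) := by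
    ring
  have h11 : 2 * (‖x‖ ^ 2 - (1 - ρ) * inner ℝ x y) / μ
      = 2 * (‖x‖ ^ 2 / μ) - 2 * ((1 - ρ) * inner ℝ x y) / μ := by ring
  rw [h10] at h7
  rw [h11]
  linarith

end

/-! ### Local rounding errors of one iteration -/

theorem EuclideanSpace.norm_le_card_mul {n : ℕ} (hn : 1 ≤ n) {z : EuclideanSpace ℝ (Fin n)}
    {c : ℝ} (h : ∀ j, |z j| ≤ c) : ‖z‖ ≤ n * c := by
  have hn' : (1 : ℝ) ≤ n := by exact_mod_cast hn
  have hc : 0 ≤ c := (abs_nonneg _).trans (h ⟨0, hn⟩)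
  refine le_of_sq_le_sq (a := ‖z‖) ?_ (by positivity)
  rw [EuclideanSpace.norm_sq_eq]
  calc ∑ j, ‖z j‖ ^ 2 ≤ ∑ _j : Fin n, c ^ 2 :=
        Finset.sum_le_sum fun j _ => pow_le_pow_left₀ (norm_nonneg _) (h j) 2
    _ = n * c ^ 2 := by simp
    _ ≤ (n * c) ^ 2 := by
      rw [mul_pow]
      exact mul_le_mul_of_nonneg_right (by nlinarith) (sq_nonneg c)

theorem EuclideanSpace.abs_coord_le_norm {n : ℕ} (z : EuclideanSpace ℝ (Fin n)) (j : Fin n) :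
    |z j| ≤ ‖z‖ := PiLp.norm_apply_le z j

/-- The errors at scale `T` and at scale `γ * T` are kept apart because γ can be large; only later
is γT compared with the size of `v`. -/
theorem abs_momentum_error {u ε T v x m m0 w z γ γh g v' : ℝ} (hu : 0 ≤ u) (huε : u ≤ ε)
    (hε : ε ≤ 1 / 1000) (hx : |x| ≤ T) (hm0 : |m0| ≤ |v| + |x|)
    (hm : |m - m0| ≤ 60 * u * (1 * |v| + 1 * |x|)) (hw : |w - z| ≤ 60 * ε * T) (hz : |z| ≤ T)
    (hγ : 0 ≤ γ) (hγh : FlRound (50 * u) γ γh) (hg : FlRound u (γh * w) g)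
    (hv' : FlRound u (m - g) v') :
    |v' - (m0 - γ * z)| ≤ 62 * u * (|v| + T) + 120 * ε * (γ * T) := by
  have hT : 0 ≤ T := (abs_nonneg _).trans hx
  have hγT : 0 ≤ γ * T := mul_nonneg hγ hT
  have hε0 : 0 ≤ ε := hu.trans huε
  have hV : 0 ≤ |v| + T := by positivity
  have c1 := mul_le_mul_of_nonneg_right hε hT
  have c2 := mul_le_mul_of_nonneg_right hε hγT
  have c3 := mul_le_mul_of_nonneg_right huε hγT
  have c4 := mul_le_mul_of_nonneg_right (huε.trans hε) hV
  have c5 : 0 ≤ ε * (γ * T) := mul_nonneg hε0 hγT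
  have hwT : |w| ≤ 1.06 * T := by
    have := abs_add_le (w - z) z
    rw [sub_add_cancel] at this
    linarith
  have hγw : |γ * w - γ * z| ≤ 60 * (ε * (γ * T)) := by
    rw [← mul_sub, abs_mul, abs_of_nonneg hγ]
    linarith [mul_le_mul_of_nonneg_left hw hγ]
  have hγabs : |γ * w| ≤ 1.06 * (γ * T) := by
    rw [abs_mul, abs_of_nonneg hγ]
    linarith [mul_le_mul_of_nonneg_left hwT hγ]
  have hγg : FlRound (52 * u) (γ * w) g := by
    have h1 : FlRound (50 * u) (γ * w) (γh * w) := by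
      simpa using hγh.mul (by positivity) (FlRound.refl le_rfl w)
    exact (h1.trans hu hg).mono (by nlinarith)
  have hgz : |g - γ * z| ≤ 116 * (ε * (γ * T)) := by
    have h1 : |g - γ * w| ≤ 52 * u * |γ * w| := hγg
    have h2 := mul_le_mul_of_nonneg_left hγabs hu
    have h3 := abs_sub_le g (γ * w) (γ * z)
    linarith
  have hgT : |g| ≤ 2 * (γ * T) := by
    have h1 : |γ * z| ≤ γ * T := by
      rw [abs_mul, abs_of_nonneg hγ]; exact mul_le_mul_of_nonneg_left hz hγ
    have := abs_add_le (g - γ * z) (γ * z)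
    rw [sub_add_cancel] at this
    linarith
  have hmm : |m - m0| ≤ 60 * (u * (|v| + T)) := by
    have := mul_le_mul_of_nonneg_left hx hu
    linarith
  have hmV : |m| ≤ 2 * (|v| + T) := by
    have := abs_add_le (m - m0) m0
    rw [sub_add_cancel] at this
    linarith
  have h1 : |v' - (m - g)| ≤ u * |m - g| := hv'
  have h2 := mul_le_mul_of_nonneg_left ((abs_sub m g).trans (add_le_add hmV hgT)) hu
  have e : v' - (m0 - γ * z) = (v' - (m - g)) + ((m - m0) - (g - γ * z)) := by ring
  rw [e]
  have h3 := abs_add_le (v' - (m - g)) ((m - m0) - (g - γ * z))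
  have h4 := abs_sub (m - m0) (g - γ * z)
  linarith

theorem abs_descent_error {u ε T x w z y' : ℝ} (hu : 0 ≤ u) (huε : u ≤ ε)
    (hε : ε ≤ 1 / 1000) (hx : |x| ≤ T) (hw : |w - z| ≤ 60 * ε * T) (hz : |z| ≤ T)
    (hy' : FlRound u (x - w) y') : |y' - (x - z)| ≤ 63 * ε * T := by
  have hT : 0 ≤ T := (abs_nonneg _).trans hx
  have c1 := mul_le_mul_of_nonneg_right hε hT
  have c2 := mul_le_mul_of_nonneg_right huε hT
  have hwT : |w| ≤ 2 * T := by
    have := abs_add_le (w - z) z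
    rw [sub_add_cancel] at this
    linarith
  have h1 : |y' - (x - w)| ≤ u * |x - w| := hy'
  have h2 := mul_le_mul_of_nonneg_left ((abs_sub x w).trans (add_le_add hx hwT)) hu
  have e : y' - (x - z) = (y' - (x - w)) - (w - z) := by ring
  rw [e]
  have h3 := abs_sub (y' - (x - w)) (w - z)
  linarith

section

variable {n : ℕ} {A : Matrix (Fin n) (Fin n) ℝ} {b : Fin n → ℝ} {u lam μ ν : ℝ}

theorem FlArk.step_x_error (run : FlArk u A b lam μ ν) (hn : 1 ≤ n) (hu : 0 < u)
    (hnu : n * u ≤ 1 / 1000) (hμ : 0 < μ) (hν : 0 < ν) (hle : μ ≤ ν) {α : ℝ}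
    (hα : α = 1 / (1 + 1 / √(μ * ν) * ν)) (h : List (Fin n)) :
    ‖run.x h - (α • run.v h + (1 - α) • run.y h)‖ ≤
      60 * (n * u) * (α * ‖run.v h‖ + ‖run.y h‖) := by
  have hn' : (1 : ℝ) ≤ n := by exact_mod_cast hn
  have hu1 : u ≤ 1 / 1000 := by nlinarith
  obtain ⟨h1, h2, -, -, -⟩ := run.par.error hu hu1 hμ hν hle
  rw [← hα] at h1 h2
  have hα0 : 0 ≤ α := by rw [hα]; positivity
  have hα1 : α ≤ 1 := by
    rw [hα, div_le_one (by positivity)]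
    have : 0 ≤ 1 / √(μ * ν) * ν := by positivity
    linarith
  unfold FlRound at h1
  rw [abs_of_nonneg hα0] at h1
  have := EuclideanSpace.norm_le_card_mul hn (c := 60 * u * (α * ‖run.v h‖ + ‖run.y h‖))
    (z := run.x h - (α • run.v h + (1 - α) • run.y h)) fun j => by
      have := FlComb.error hu.le hu1 (abs_of_nonneg hα0).le
        (α' := 1 - α) (a' := 1) (by rw [abs_of_nonneg (by linarith)]; linarith) h1 (by linarith)
        (run.step_x h j)
      have hv := EuclideanSpace.abs_coord_le_norm (run.v h) j
      have hy := EuclideanSpace.abs_coord_le_norm (run.y h) j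
      refine this.trans (mul_le_mul_of_nonneg_left ?_ (by positivity))
      have := mul_le_mul_of_nonneg_left hv hα0
      linarith
  linarith

theorem FlArk.step_w_error (run : FlArk u A b lam μ ν) (hn : 1 ≤ n) (hu : 0 < u)
    (hnu : n * u ≤ 1 / 1000) (hlam : 0 ≤ lam) (hR : ∀ i, 0 < rowSq A i + lam)
    {xs : EuclideanSpace ℝ (Fin n)} (hxs : ∀ i, A.toEuclideanLin xs i = b i)
    (h : List (Fin n)) (i j : Fin n) :
    |run.w h i j - rowUpdate A lam i (run.x h - xs) j| ≤
      60 * (n * u) * (‖run.x h‖ + ‖xs‖) := by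
  have h1 := (run.step_w h i).error hn hu.le hnu (run.round_A i) (run.round_b i) run.round_lam hlam
    (hR i) (t := ‖run.x h‖ + ‖xs‖) (by positivity) ?_ j
  · rw [rowUpdate, map_sub, PiLp.sub_apply, hxs, toEuclideanLin_coord]
    exact h1
  · have h2 := abs_sum_row_mul_le A i (run.x h)
    have h3 := (Finset.abs_sum_le_sum_abs _ _).trans (abs_sum_row_mul_le A i xs)
    rw [← toEuclideanLin_coord, hxs] at h3
    rw [mul_add]
    exact add_le_add h2 h3

theorem FlArk.step_y_error (run : FlArk u A b lam μ ν) (hn : 1 ≤ n) (hu : 0 < u)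
    (hnu : n * u ≤ 1 / 1000) (hlam : 0 ≤ lam) (hR : ∀ i, 0 < rowSq A i + lam)
    {xs : EuclideanSpace ℝ (Fin n)} (hxs : ∀ i, A.toEuclideanLin xs i = b i)
    (h : List (Fin n)) (i : Fin n) :
    ‖run.y (i :: h) - (run.x h - rowUpdate A lam i (run.x h - xs))‖ ≤
      63 * (n ^ 2 * u) * (‖run.x h‖ + ‖xs‖) := by
  have hn' : (1 : ℝ) ≤ n := by exact_mod_cast hn
  have huε : u ≤ n * u := by nlinarith
  have := EuclideanSpace.norm_le_card_mul hn (c := 63 * (n * u) * (‖run.x h‖ + ‖xs‖))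
    (z := run.y (i :: h) - (run.x h - rowUpdate A lam i (run.x h - xs))) fun j =>
      abs_descent_error hu.le huε hnu
        ((EuclideanSpace.abs_coord_le_norm _ j).trans (by linarith [norm_nonneg xs]))
        (run.step_w_error hn hu hnu hlam hR hxs h i j)
        ((EuclideanSpace.abs_coord_le_norm _ j).trans
          ((norm_rowUpdate_le hlam i _).trans (norm_sub_le _ _)))
        (run.step_y h i j)
  linarith

theorem FlArk.step_v_error (run : FlArk u A b lam μ ν) (hn : 1 ≤ n) (hu : 0 < u)
    (hnu : n * u ≤ 1 / 1000) (hμ : 0 < μ) (hν : 0 < ν) (hle : μ ≤ ν)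
    (hlam : 0 ≤ lam) (hR : ∀ i, 0 < rowSq A i + lam)
    {xs : EuclideanSpace ℝ (Fin n)} (hxs : ∀ i, A.toEuclideanLin xs i = b i) {ρ γ : ℝ}
    (hρ : ρ = √(μ / ν)) (hγ : γ = 1 / √(μ * ν)) (h : List (Fin n)) (i : Fin n) :
    ‖run.v (i :: h) -
        ((1 - ρ) • run.v h + ρ • run.x h - γ • rowUpdate A lam i (run.x h - xs))‖ ≤
      62 * (n * u) * (‖run.v h‖ + (‖run.x h‖ + ‖xs‖)) +
        120 * (n ^ 2 * u) * (γ * (‖run.x h‖ + ‖xs‖)) := by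
  have hn' : (1 : ℝ) ≤ n := by exact_mod_cast hn
  have huε : u ≤ n * u := by nlinarith
  have hu1 : u ≤ 1 / 1000 := by linarith
  obtain ⟨-, -, h1, h2, h3⟩ := run.par.error hu hu1 hμ hν hle
  rw [← hρ] at h1 h2
  rw [← hγ] at h3
  have hγ0 : 0 ≤ γ := by rw [hγ]; positivity
  have hρ0 : 0 ≤ ρ := by rw [hρ]; positivity
  have hρ1 : ρ ≤ 1 := by rw [hρ]; exact Real.sqrt_le_one.2 ((div_le_one hν).2 hle)
  set T := ‖run.x h‖ + ‖xs‖ with hT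
  have := EuclideanSpace.norm_le_card_mul hn
    (c := 62 * u * (‖run.v h‖ + T) + 120 * (n * u) * (γ * T))
    (z := run.v (i :: h) -
        ((1 - ρ) • run.v h + ρ • run.x h - γ • rowUpdate A lam i (run.x h - xs))) fun j => by
      obtain ⟨m, g, hm, hg, hv⟩ := run.step_v h i j
      have hβabs : |1 - ρ| ≤ 1 := by rw [abs_of_nonneg (by linarith)]; linarith
      have hρabs : |ρ| ≤ 1 := by rwa [abs_of_nonneg hρ0]
      have hm' := FlComb.error hu.le hu1 hβabs hρabs (by linarith) (by linarith) hm
      have hm0 : |(1 - ρ) * run.v h j + ρ * run.x h j| ≤ |run.v h j| + |run.x h j| := by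
        refine (abs_add_le _ _).trans ?_
        rw [abs_mul, abs_mul]
        exact add_le_add (mul_le_of_le_one_left (abs_nonneg _) hβabs)
          (mul_le_of_le_one_left (abs_nonneg _) hρabs)
      have key := abs_momentum_error (T := T) hu.le huε hnu
        ((EuclideanSpace.abs_coord_le_norm _ j).trans (by linarith [norm_nonneg xs])) hm0 hm'
        (run.step_w_error hn hu hnu hlam hR hxs h i j)
        ((EuclideanSpace.abs_coord_le_norm _ j).trans
          ((norm_rowUpdate_le hlam i _).trans (norm_sub_le _ _))) hγ0 h3 hg hv
      refine key.trans ?_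
      have := mul_le_mul_of_nonneg_left (EuclideanSpace.abs_coord_le_norm (run.v h) j) hu.le
      linarith
  linarith

end

/-! ### One floating-point step in the Lyapunov function -/

section

variable {n : ℕ} {A : Matrix (Fin n) (Fin n) ℝ} {b : Fin n → ℝ} {u lam μ ν : ℝ}

/-- `M` bounds the computed `v` and `s * M` the computed `y`, solution included. As α ≤ s, the
computed `x` also has size O(sM), and the large factor γ = 1/(st) is harmless since γs ≤ 1. The
error `e` committed in forming `x` is carried through the rest of the step by linearity of the row
update. -/
theorem FlArk.step_perturbation (run : FlArk u A b lam μ ν) (hn : 1 ≤ n) (hu : 0 < u)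
    (hnu : n * u ≤ 1 / 1000) {s t : ℝ} (hs : 0 < s) (hs1 : s ≤ 1) (ht : 1 ≤ t) (hμ : μ = s ^ 2)
    (hν : ν = t ^ 2) (hlam : 0 ≤ lam) (hR : ∀ i, 0 < rowSq A i + lam)
    {xs xe : EuclideanSpace ℝ (Fin n)} (hxs : ∀ i, A.toEuclideanLin xs i = b i) {N M : ℝ}
    (h : List (Fin n)) (hv : ‖run.v h - xs‖ ≤ N) (hy : ‖run.y h - xs‖ ≤ s * N)
    (hM : s * M = s * N + ‖xs‖)
    (hxe : xe = (s / (s + t)) • (run.v h - xs) + (1 - s / (s + t)) • (run.y h - xs)) :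
    ‖run.x h - xs‖ ≤ 2 * (s * N) + 120 * (n * u) * (s * M) ∧ ∀ i,
    ‖run.v (i :: h) - xs - ((1 - s / t) • (run.v h - xs) + (s / t) • xe
      - (1 / (s * t)) • rowUpdate A lam i xe)‖ ≤ 850 * (n ^ 2 * u) * M ∧
    ‖run.y (i :: h) - xs - (xe - rowUpdate A lam i xe)‖ ≤ 430 * (n ^ 2 * u) * (s * M) := by
  have hn' : (1 : ℝ) ≤ n := by exact_mod_cast hn
  have ht0 : 0 < t := by linarith
  have hμ0 : 0 < μ := by rw [hμ]; positivity
  have hν0 : 0 < ν := by rw [hν]; positivity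
  have hle : μ ≤ ν := by rw [hμ, hν]; nlinarith
  have hγ : 1 / (s * t) = 1 / √(μ * ν) := by
    rw [hμ, hν, ← mul_pow, Real.sqrt_sq (by positivity)]
  have hρ : s / t = √(μ / ν) := by
    rw [hμ, hν, ← div_pow, Real.sqrt_sq (by positivity)]
  have hα : s / (s + t) = 1 / (1 + 1 / √(μ * ν) * ν) := by
    rw [← hγ, hν]; field_simp
  have hN0 : 0 ≤ N := (norm_nonneg _).trans hv
  set X := ‖xs‖ with hX
  have hX0 : 0 ≤ X := norm_nonneg _
  have hsN : 0 ≤ s * N := by positivity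
  have hsM : 0 ≤ s * M := by rw [hM]; positivity
  have hM0 : 0 ≤ M := nonneg_of_mul_nonneg_right hsM hs
  have hNXM : N + X ≤ M := by
    have h1 : s * (N + X) ≤ s * M := by rw [hM]; nlinarith
    exact le_of_mul_le_mul_left h1 hs
  have hsMM : s * M ≤ M := mul_le_of_le_one_left hM0 hs1
  have hvn : ‖run.v h‖ ≤ M := by
    have := norm_add_le (run.v h - xs) xs
    rw [sub_add_cancel] at this
    linarith
  have hyn : ‖run.y h‖ ≤ s * M := by
    have := norm_add_le (run.y h - xs) xs
    rw [sub_add_cancel] at this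
    linarith
  have hα0 : 0 ≤ s / (s + t) := by positivity
  have hα1 : 0 ≤ 1 - s / (s + t) := by
    have : s / (s + t) ≤ 1 := (div_le_one (by positivity)).2 (by linarith)
    linarith
  have hαs : s / (s + t) ≤ s := div_le_self hs.le (by linarith)
  have hx := run.step_x_error hn hu hnu hμ0 hν0 hle hα h
  have he : run.x h - xs - xe = run.x h - ((s / (s + t)) • run.v h
      + (1 - s / (s + t)) • run.y h) := by rw [hxe]; module
  rw [← he] at hx
  generalize s / (s + t) = α at *
  have hnu0 : 0 ≤ (n : ℝ) * u := by positivity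
  have hee : ‖run.x h - xs - xe‖ ≤ 120 * (n * u * (s * M)) := by
    have h1 : α * ‖run.v h‖ ≤ s * M := by gcongr
    have h2 := mul_le_mul_of_nonneg_left (add_le_add h1 hyn) hnu0
    linarith
  have hxen : ‖xe‖ ≤ 2 * (s * N) := by
    rw [hxe]
    refine (norm_add_le _ _).trans ?_
    rw [norm_smul, norm_smul, Real.norm_of_nonneg hα0, Real.norm_of_nonneg hα1]
    have h1 : α * ‖run.v h - xs‖ ≤ s * N := by gcongr
    have h2 : (1 - α) * ‖run.y h - xs‖ ≤ 1 * (s * N) := by gcongr; linarith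
    linarith
  have hxx : ‖run.x h - xs‖ ≤ 2 * (s * N) + 120 * (n * u) * (s * M) := by
    have := norm_add_le (run.x h - xs - xe) xe
    rw [sub_add_cancel] at this
    linarith
  refine ⟨hxx, fun i => ?_⟩
  have hnuM := mul_le_mul_of_nonneg_right hnu hsM
  have hT : ‖run.x h‖ + X ≤ 3 * (s * M) := by
    have := norm_add_le (run.x h - xs) xs
    rw [sub_add_cancel] at this
    linarith
  have hnn : (n : ℝ) * u ≤ n ^ 2 * u := by nlinarith
  have hn2 : 0 ≤ (n : ℝ) ^ 2 * u := by positivity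
  set e := run.x h - xs - xe with hedef
  have hxadd : run.x h - xs = xe + e := by rw [hedef]; abel
  have hUe := norm_rowUpdate_le (A := A) hlam i e
  have k1 := mul_le_mul_of_nonneg_right hnn hsM
  have k2 := mul_le_mul_of_nonneg_left hT hn2
  constructor
  · have h1 := run.step_v_error hn hu hnu hμ0 hν0 hle hlam hR hxs hρ hγ h i
    have hρ0 : 0 ≤ s / t := by positivity
    have hρ1 : s / t ≤ 1 := (div_le_one ht0).2 (by linarith)
    have hγ0 : 0 ≤ 1 / (s * t) := by positivity
    have hγs : 1 / (s * t) * s ≤ 1 := by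
      rw [one_div_mul_eq_div, div_le_one (by positivity)]
      exact le_mul_of_one_le_right hs.le ht
    have hγM : 1 / (s * t) * (s * M) ≤ M := by
      rw [← mul_assoc]; exact mul_le_of_le_one_left hM0 hγs
    rw [hxadd, rowUpdate_add, ← hX] at h1
    generalize s / t = ρ at *
    generalize 1 / (s * t) = γ at *
    have e1 : run.v (i :: h) - xs - ((1 - ρ) • (run.v h - xs) + ρ • xe
        - γ • rowUpdate A lam i xe) = (run.v (i :: h) - ((1 - ρ) • run.v h + ρ • run.x h
        - γ • (rowUpdate A lam i xe + rowUpdate A lam i e))) + (ρ • e - γ • rowUpdate A lam i e) := by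
      have : run.x h = xs + xe + e := by rw [hedef]; abel
      rw [this]; module
    have e2 : ‖ρ • e - γ • rowUpdate A lam i e‖ ≤ ‖e‖ + γ * ‖e‖ := by
      refine (norm_sub_le _ _).trans ?_
      rw [norm_smul, norm_smul, Real.norm_of_nonneg hρ0, Real.norm_of_nonneg hγ0]
      exact add_le_add (mul_le_of_le_one_left (norm_nonneg _) hρ1)
        (mul_le_mul_of_nonneg_left hUe hγ0)
    rw [e1]
    refine (norm_add_le _ _).trans ?_
    have k3 : γ * (‖run.x h‖ + X) ≤ 3 * M := by
      linarith [mul_le_mul_of_nonneg_left hT hγ0]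
    have k4 := mul_le_mul_of_nonneg_left k3 hn2
    have k5 : γ * ‖e‖ ≤ 120 * (n * u * M) := by
      have := mul_le_mul_of_nonneg_left hee hγ0
      linarith [mul_le_mul_of_nonneg_left hγM hnu0]
    have k6 : ‖run.v h‖ + (‖run.x h‖ + X) ≤ 4 * M := by linarith
    have k7 := mul_le_mul_of_nonneg_left k6 hnu0
    have k8 := mul_le_mul_of_nonneg_right hnn hM0
    have k9 := mul_le_mul_of_nonneg_left hsMM hnu0
    have k10 := mul_nonneg hn2 hM0
    linarith
  · have h1 := run.step_y_error hn hu hnu hlam hR hxs h i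
    rw [hxadd, rowUpdate_add, ← hX] at h1
    have e1 : run.y (i :: h) - xs - (xe - rowUpdate A lam i xe)
        = (run.y (i :: h) - (run.x h - (rowUpdate A lam i xe + rowUpdate A lam i e)))
          + (e - rowUpdate A lam i e) := by
      have : run.x h = xs + xe + e := by rw [hedef]; abel
      rw [this]; module
    rw [e1]
    refine (norm_add_le _ _).trans ?_
    have := norm_sub_le e (rowUpdate A lam i e)
    have := mul_nonneg hn2 hsM
    linarith

theorem norm_sq_le_arkLyapunov (hA : IsUnit A) {S : ℝ} (hS : frobNorm A ^ 2 ≤ S) (hμ : 0 < μ)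
    (v y : EuclideanSpace ℝ (Fin n)) : ‖v‖ ^ 2 ≤ arkLyapunov A S μ v y := by
  have h1 := pow_le_pow_left₀ (norm_nonneg _) (norm_le_frobNorm_mul_norm_invTranspose hA v) 2
  rw [mul_pow] at h1
  have h2 := mul_le_mul_of_nonneg_right hS (sq_nonneg ‖invTranspose A v‖)
  have h3 : 0 ≤ ‖y‖ ^ 2 / μ := by positivity
  unfold arkLyapunov
  linarith

theorem norm_sq_le_mul_arkLyapunov {S : ℝ} (hS : 0 ≤ S) (hμ : 0 < μ)
    (v y : EuclideanSpace ℝ (Fin n)) : ‖y‖ ^ 2 ≤ μ * arkLyapunov A S μ v y := by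
  have h1 : μ * arkLyapunov A S μ v y = μ * (S * ‖invTranspose A v‖ ^ 2) + ‖y‖ ^ 2 := by
    unfold arkLyapunov; field_simp
  rw [h1]
  have : 0 ≤ μ * (S * ‖invTranspose A v‖ ^ 2) := by positivity
  linarith

theorem arkLyapunov_le_of_norm_le {S a c : ℝ} (hμ : 0 < μ)
    (hstar : ∀ z, S * ‖invTranspose A z‖ ^ 2 ≤ ‖z‖ ^ 2 / μ) {v y : EuclideanSpace ℝ (Fin n)}
    (hv : ‖v‖ ≤ a) (hy : ‖y‖ ≤ c) : arkLyapunov A S μ v y ≤ (a ^ 2 + c ^ 2) / μ := by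
  have h1 := hstar v
  have h2 := div_le_div_of_nonneg_right (pow_le_pow_left₀ (norm_nonneg _) hv 2) hμ.le
  have h3 := div_le_div_of_nonneg_right (pow_le_pow_left₀ (norm_nonneg _) hy 2) hμ.le
  rw [add_div]
  unfold arkLyapunov
  linarith

/-- One floating-point step contracts the Lyapunov function in expectation, up to a term of the
size of the squared local error. -/
theorem FlArk.sum_lyapunov_le (run : FlArk u A b lam μ ν) (hA : IsUnit A) (hn : 1 ≤ n)
    (hu : 0 < u) (hnu : n * u ≤ 1 / 1000) {s t S m : ℝ} (hs : 0 < s) (hs1 : s ≤ 1) (ht : 1 ≤ t)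
    (hμ : μ = s ^ 2) (hν : ν = t ^ 2) (hlam : 0 ≤ lam) (hm : 0 < m)
    (hmR : ∀ i, m ≤ rowSq A i + lam) (hS : S = ∑ i, (rowSq A i + lam))
    (hFS : frobNorm A ^ 2 ≤ S) (hS0 : 0 < S) (hνS : ν = S / m)
    (hstar : ∀ z, S * ‖invTranspose A z‖ ^ 2 ≤ ‖z‖ ^ 2 / μ)
    {xs : EuclideanSpace ℝ (Fin n)} (hxs : ∀ i, A.toEuclideanLin xs i = b i)
    {ε : ℝ} (hε : ε = 1000 * (n ^ 2 * u) / s) (hερ : 40 * ε ^ 2 ≤ (s / t) ^ 2)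
    (h : List (Fin n)) :
    ∑ i, (rowSq A i + lam) / S *
        arkLyapunov A S μ (run.v (i :: h) - xs) (run.y (i :: h) - xs) ≤
      (1 - s / t / 2) * arkLyapunov A S μ (run.v h - xs) (run.y h - xs)
        + 10 * ε ^ 2 / (s / t) * (‖xs‖ / s) ^ 2 := by
  have hμ0 : 0 < μ := by rw [hμ]; positivity
  have ht0 : 0 < t := by linarith
  set L := arkLyapunov A S μ (run.v h - xs) (run.y h - xs) with hL
  have hL0 : 0 ≤ L := arkLyapunov_nonneg hS0.le hμ0.le _ _
  have hv : ‖run.v h - xs‖ ≤ √L := Real.le_sqrt_of_sq_le (norm_sq_le_arkLyapunov hA hFS hμ0 _ _)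
  have hy : ‖run.y h - xs‖ ≤ s * √L := by
    have := Real.le_sqrt_of_sq_le
      (norm_sq_le_mul_arkLyapunov (A := A) hS0.le hμ0 (run.v h - xs) (run.y h - xs))
    have hsμ : √μ = s := by rw [hμ, Real.sqrt_sq hs.le]
    rwa [Real.sqrt_mul hμ0.le, hsμ] at this
  set X := ‖xs‖ with hX
  set M := √L + X / s with hM
  have hM0 : 0 ≤ M := by positivity
  have hsM : s * M = s * √L + X := by rw [hM]; field_simp
  set xe := (s / (s + t)) • (run.v h - xs) + (1 - s / (s + t)) • (run.y h - xs) with hxe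
  obtain ⟨-, hstep⟩ := run.step_perturbation hn hu hnu hs hs1 ht hμ hν hlam
    (fun i => hm.trans_le (hmR i)) hxs h hv hy hsM hxe
  have hρ0 : 0 < s / t := by positivity
  have hρ1 : s / t ≤ 1 := (div_le_one ht0).2 (by linarith)
  -- With γν = t/s, the coefficient α is s/(s+t), which is the coupling required by the exact step.
  have hxe' : (1 + s / t) • xe = (s / t) • (run.v h - xs) + (run.y h - xs) := by
    have e1 : (1 + s / t) * (s / (s + t)) = s / t := by field_simp; ring
    have e2 : (1 + s / t) * (1 - s / (s + t)) = 1 := by field_simp; ring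
    rw [hxe, smul_add, smul_smul, smul_smul, e1, e2, one_smul]
  have hexact := sum_arkLyapunov_step_le hA (γ := 1 / (s * t)) hm hmR hS hS0 hlam hμ0 hρ0 hρ1 hνS
    (by rw [hν]; field_simp) (by rw [hμ]; field_simp) hstar hxe'
  rw [← hL] at hexact
  set ρ := s / t with hρ
  have hterm : ∀ i, arkLyapunov A S μ (run.v (i :: h) - xs) (run.y (i :: h) - xs) ≤
      (1 + ρ / 4) * arkLyapunov A S μ ((1 - ρ) • (run.v h - xs) + ρ • xe
        - (1 / (s * t)) • rowUpdate A lam i xe) (xe - rowUpdate A lam i xe)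
      + 5 / ρ * (ε ^ 2 * M ^ 2) := by
    intro i
    obtain ⟨hdv, hdy⟩ := hstep i
    -- Young weight ρ/4: it costs only a quarter of the contraction and inflates the squared
    -- rounding error by at most 5/ρ.
    have h1 := arkLyapunov_add_le (A := A) hS0.le hμ0.le (s := ρ / 4) (by positivity)
      ((1 - ρ) • (run.v h - xs) + ρ • xe - (1 / (s * t)) • rowUpdate A lam i xe)
      (xe - rowUpdate A lam i xe)
      (run.v (i :: h) - xs - ((1 - ρ) • (run.v h - xs) + ρ • xe
      - (1 / (s * t)) • rowUpdate A lam i xe))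
      (run.y (i :: h) - xs - (xe - rowUpdate A lam i xe))
    rw [add_sub_cancel, add_sub_cancel] at h1
    refine h1.trans (add_le_add_right ?_ _)
    have h2 : 1 + 1 / (ρ / 4) ≤ 5 / ρ := by
      rw [one_div_div]
      have : 1 ≤ 1 / ρ := (one_le_div hρ0).2 hρ1
      have e : 5 / ρ = 1 / ρ + 4 / ρ := by ring
      linarith
    refine mul_le_mul h2 ?_ (arkLyapunov_nonneg hS0.le hμ0.le _ _) (by positivity)
    refine (arkLyapunov_le_of_norm_le hμ0 hstar hdv hdy).trans ?_
    have h7 : ε ^ 2 * M ^ 2 = (1000 * (n ^ 2 * u * M)) ^ 2 / μ := by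
      rw [hε, hμ]; field_simp
    rw [h7]
    refine div_le_div_of_nonneg_right ?_ hμ0.le
    have h5 : 430 * (n ^ 2 * u) * (s * M) ≤ 430 * (n ^ 2 * u * M) := by
      have := mul_le_mul_of_nonneg_left (mul_le_of_le_one_left hM0 hs1)
        (by positivity : 0 ≤ 430 * (n ^ 2 * u))
      linarith
    -- The factor 1000 in ε comes from 850² + 430² ≤ 1000².
    have h6 := pow_le_pow_left₀ (by positivity) h5 2
    have h8 := sq_nonneg ((n : ℝ) ^ 2 * u * M)
    linarith
  have hp : ∑ i, (rowSq A i + lam) / S = 1 := by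
    rw [← Finset.sum_div, ← hS, div_self hS0.ne']
  calc _ ≤ ∑ i, (rowSq A i + lam) / S * ((1 + ρ / 4) *
        arkLyapunov A S μ ((1 - ρ) • (run.v h - xs) + ρ • xe
        - (1 / (s * t)) • rowUpdate A lam i xe) (xe - rowUpdate A lam i xe)
      + 5 / ρ * (ε ^ 2 * M ^ 2)) := Finset.sum_le_sum fun i _ =>
        mul_le_mul_of_nonneg_left (hterm i) (div_nonneg (hm.trans_le (hmR i)).le hS0.le)
    _ = (1 + ρ / 4) * ∑ i, (rowSq A i + lam) / S * arkLyapunov A S μ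
        ((1 - ρ) • (run.v h - xs) + ρ • xe
        - (1 / (s * t)) • rowUpdate A lam i xe) (xe - rowUpdate A lam i xe)
        + 5 / ρ * (ε ^ 2 * M ^ 2) := by
      simp_rw [mul_add]
      rw [Finset.sum_add_distrib, ← Finset.sum_mul, hp, one_mul, Finset.mul_sum]
      congr 1
      exact Finset.sum_congr rfl fun i _ => by ring
    _ ≤ (1 + ρ / 4) * ((1 - ρ) * L) + 5 / ρ * (ε ^ 2 * (2 * (L + (X / s) ^ 2))) := by
      have hM2 : M ^ 2 ≤ 2 * (L + (X / s) ^ 2) := by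
        have := Real.sq_sqrt hL0
        rw [hM]
        nlinarith [sq_nonneg (√L - X / s)]
      gcongr
    _ ≤ _ := by
      -- The part of the rounding error proportional to `L` uses up another quarter of ρ: (1 +
      -- ρ/4)(1 - ρ) + ρ/4 ≤ 1 - ρ/2.
      have h1 : 10 * ε ^ 2 / ρ ≤ ρ / 4 := by
        rw [div_le_iff₀ hρ0]; linarith
      have h2 := mul_le_mul_of_nonneg_right h1 hL0
      have e : 5 / ρ * (ε ^ 2 * (2 * (L + (X / s) ^ 2)))
          = 10 * ε ^ 2 / ρ * L + 10 * ε ^ 2 / ρ * (X / s) ^ 2 := by ring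
      rw [e]
      nlinarith [mul_nonneg (sq_nonneg ρ) hL0]

end

/-! ### Random rows and conditioning on the history -/

section Sampling

variable {n : ℕ} {A : Matrix (Fin n) (Fin n) ℝ} {lam : ℝ} {Ω : Type*} [MeasurableSpace Ω]
  {P : Measure Ω} {r : ℕ → Ω → Fin n}

/-- The history factors through finitely many values. Hence every real function of it is integrable
and independent of the next row, whatever the rounding errors do. -/
theorem exists_drawn_eq {Ω : Type*} (r : ℕ → Ω → Fin n) (k : ℕ) :
    ∃ F : (Finset.range k → Fin n) → List (Fin n), ∀ ω, drawn r k ω = F fun j => r j ω := by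
  induction k with
  | zero => exact ⟨fun _ => [], fun _ => rfl⟩
  | succ k ih =>
    obtain ⟨F, hF⟩ := ih
    refine ⟨fun t => t ⟨k, Finset.self_mem_range_succ k⟩ ::
      F fun j => t ⟨j, Finset.mem_range.2 ((Finset.mem_range.1 j.2).trans k.lt_succ_self)⟩,
      fun ω => ?_⟩
    rw [drawn, hF]

theorem IsArkSampling.integrable_comp_drawn [IsProbabilityMeasure P]
    (hr : IsArkSampling A lam P r) (g : List (Fin n) → ℝ) (k : ℕ) :
    Integrable (fun ω => g (drawn r k ω)) P := by
  obtain ⟨F, hF⟩ := exists_drawn_eq r k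
  have hX : Measurable fun ω => fun j : Finset.range k => r j ω :=
    measurable_pi_lambda _ fun j => hr.measurable j
  have : IsProbabilityMeasure (P.map fun ω => fun j : Finset.range k => r j ω) :=
    Measure.isProbabilityMeasure_map hX.aemeasurable
  simp_rw [hF]
  exact (Integrable.of_finite (μ := P.map fun ω => fun j : Finset.range k => r j ω)
    (f := fun t => g (F t))).comp_measurable hX

theorem IsArkSampling.indepFun_drawn (hr : IsArkSampling A lam P r) (k : ℕ)
    (f : Fin n → ℝ) (g : List (Fin n) → ℝ) :
    IndepFun (fun ω => f (r k ω)) (fun ω => g (drawn r k ω)) P := by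
  obtain ⟨F, hF⟩ := exists_drawn_eq r k
  have h := hr.indep.indepFun_finset {k} (Finset.range k) (by simp) hr.measurable
  have h' := h.comp (φ := fun t => f (t ⟨k, Finset.mem_singleton_self k⟩))
    (ψ := fun t => g (F t)) (measurable_of_finite _) (measurable_of_finite _)
  simp_rw [hF]
  exact h'

theorem IsArkSampling.integral_drawn_succ [IsProbabilityMeasure P]
    (hr : IsArkSampling A lam P r) {S : ℝ} (hS : S = ∑ l, (rowSq A l + lam))
    (hp : ∀ i, 0 ≤ (rowSq A i + lam) / S) (g : List (Fin n) → ℝ) (k : ℕ) :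
    ∫ ω, g (drawn r (k + 1) ω) ∂P =
      ∫ ω, ∑ i, (rowSq A i + lam) / S * g (i :: drawn r k ω) ∂P := by
  -- Splitting by the new row leaves products of an indicator of `r k` and a function of the past,
  -- whose expectations factor.
  have hsplit : ∀ ω, g (drawn r (k + 1) ω) =
      ∑ i, (if r k ω = i then (1 : ℝ) else 0) * g (i :: drawn r k ω) := fun ω => by
    simp [drawn]
  have hmeas : ∀ i, MeasurableSet (r k ⁻¹' {i}) := fun i =>
    hr.measurable k (measurableSet_singleton i)
  have hind : ∀ i, (fun ω => if r k ω = i then (1 : ℝ) else 0) = (r k ⁻¹' {i}).indicator 1 :=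
    fun i => by ext ω; by_cases h : r k ω = i <;> simp [h]
  have hint : ∀ i, Integrable (fun ω => if r k ω = i then (1 : ℝ) else 0) P := fun i => by
    rw [hind]; exact (integrable_const 1).indicator (hmeas i)
  have hindep := fun i => hr.indepFun_drawn k (fun l => if l = i then (1 : ℝ) else 0)
    (fun h => g (i :: h))
  have hprod : ∀ i, Integrable
      (fun ω => (if r k ω = i then (1 : ℝ) else 0) * g (i :: drawn r k ω)) P := fun i =>
    (hindep i).integrable_mul (hint i) (hr.integrable_comp_drawn (fun h => g (i :: h)) k)
  simp_rw [hsplit]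
  rw [integral_finsetSum _ fun i _ => hprod i,
    integral_finsetSum _ fun i _ =>
      (hr.integrable_comp_drawn (fun h => g (i :: h)) k).const_mul _]
  refine Finset.sum_congr rfl fun i _ => ?_
  rw [integral_const_mul]
  refine ((hindep i).integral_fun_mul_eq_mul_integral (hint i).aestronglyMeasurable
    (hr.integrable_comp_drawn (fun h => g (i :: h)) k).aestronglyMeasurable).trans ?_
  congr 1
  rw [hind, integral_indicator_one (hmeas i), Measure.real, hr.law, ← hS,
    ENNReal.toReal_ofReal (hp i)]

end Sampling

/-! ### Bounds on the acceleration parameters -/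

section Parameters

variable {n : ℕ} {A : Matrix (Fin n) (Fin n) ℝ} {lam : ℝ}

theorem frobNorm_pos (hn : 1 ≤ n) (hA : IsUnit A) : 0 < frobNorm A := by
  have h1 := sigmaMin_mul_norm_le A (EuclideanSpace.single ⟨0, hn⟩ (1 : ℝ))
  have h2 := norm_toEuclideanLin_le A (EuclideanSpace.single ⟨0, hn⟩ (1 : ℝ))
  have h3 := sigmaMin_pos hn hA
  simp only [PiLp.norm_single, norm_one, mul_one] at h1 h2
  linarith

theorem sigmaMin_le_frobNorm (hn : 1 ≤ n) (A : Matrix (Fin n) (Fin n) ℝ) :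
    sigmaMin A ≤ frobNorm A := by
  have h1 := sigmaMin_mul_norm_le A (EuclideanSpace.single ⟨0, hn⟩ (1 : ℝ))
  have h2 := norm_toEuclideanLin_le A (EuclideanSpace.single ⟨0, hn⟩ (1 : ℝ))
  simp only [PiLp.norm_single, norm_one, mul_one] at h1 h2
  linarith

theorem one_le_demmelCond (hn : 1 ≤ n) (hA : IsUnit A) : 1 ≤ demmelCond A :=
  (one_le_sigmaMin_mul_norm_inv hn hA).trans
    (mul_le_mul_of_nonneg_right (sigmaMin_le_frobNorm hn A) (norm_nonneg _))

theorem iInf_rowSq_le (A : Matrix (Fin n) (Fin n) ℝ) (i : Fin n) : ⨅ i, rowSq A i ≤ rowSq A i :=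
  ciInf_le (Set.finite_range _).bddBelow i

theorem iInf_rowSq_nonneg (A : Matrix (Fin n) (Fin n) ℝ) : 0 ≤ ⨅ i, rowSq A i :=
  Real.iInf_nonneg (rowSq_nonneg A)

theorem frobNorm_sq_le_iSup (A : Matrix (Fin n) (Fin n) ℝ) :
    frobNorm A ^ 2 ≤ n * ⨆ i, rowSq A i := by
  rw [frobNorm_sq]
  calc ∑ i, rowSq A i ≤ ∑ _i : Fin n, ⨆ i, rowSq A i :=
        Finset.sum_le_sum fun i _ => le_ciSup (Set.finite_range (rowSq A)).bddAbove i
    _ = _ := by simp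

/-- The quantitative content of the two admissible choices of the regularization parameter. -/
theorem ark_regularization (hn : 1 ≤ n) (hA : IsUnit A)
    (hlam : lam = frobNorm A ^ 2 / n ∨ (lam = 0 ∧ (⨆ i, rowSq A i) ≤ 4 * ⨅ i, rowSq A i)) :
    0 ≤ lam ∧ frobNorm A ^ 2 + n * lam ≤ 2 * frobNorm A ^ 2 ∧
    frobNorm A ^ 2 + n * lam ≤ 4 * n * ((⨅ i, rowSq A i) + lam) ∧
    (frobNorm A ^ 2 + n * lam) ^ 2 ≤ 4 * n * frobNorm A ^ 2 * ((⨅ i, rowSq A i) + lam) := by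
  have hn' : (1 : ℝ) ≤ n := by exact_mod_cast hn
  have hF := frobNorm_pos hn hA
  have hI := iInf_rowSq_nonneg A
  have hF2 : 0 < frobNorm A ^ 2 := by positivity
  rcases hlam with h | ⟨h, hle⟩
  · have h1 : n * lam = frobNorm A ^ 2 := by rw [h]; field_simp
    have h2 : 0 ≤ n * ⨅ i, rowSq A i := by positivity
    refine ⟨by rw [h]; positivity, by linarith, by linarith, ?_⟩
    nlinarith
  · have h1 := frobNorm_sq_le_iSup A
    -- Nearly equal rows: ‖A‖_F² ≤ n max‖aᵢ‖² ≤ 4n min‖aᵢ‖².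
    have h2 : frobNorm A ^ 2 ≤ 4 * (n * ⨅ i, rowSq A i) := by nlinarith
    subst h
    refine ⟨le_rfl, by linarith, by linarith, ?_⟩
    nlinarith

theorem sum_rowSq_add (A : Matrix (Fin n) (Fin n) ℝ) (lam : ℝ) :
    ∑ i, (rowSq A i + lam) = frobNorm A ^ 2 + n * lam := by
  rw [Finset.sum_add_distrib, frobNorm_sq]; simp

theorem ark_parameter_bounds (hn : 1 ≤ n) (hA : IsUnit A)
    (hlam : lam = frobNorm A ^ 2 / n ∨ (lam = 0 ∧ (⨆ i, rowSq A i) ≤ 4 * ⨅ i, rowSq A i)) :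
    0 < (⨅ i, rowSq A i) + lam ∧ 0 < frobNorm A ^ 2 + n * lam ∧ 0 < arkMu A lam ∧
    arkMu A lam ≤ 1 ∧ 1 ≤ arkNu A lam ∧ arkNu A lam ≤ 4 * n ∧
    1 ≤ 2 * (demmelCond A ^ 2 * arkMu A lam) ∧
    arkNu A lam ≤ 4 * n * (demmelCond A ^ 2 * arkMu A lam) := by
  obtain ⟨hl0, h2F, h4, hsq⟩ := ark_regularization hn hA hlam
  have hn' : (1 : ℝ) ≤ n := by exact_mod_cast hn
  have hF := frobNorm_pos hn hA
  have hσ := sigmaMin_pos hn hA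
  have hS : 0 < frobNorm A ^ 2 + n * lam := by positivity
  have hm : 0 < (⨅ i, rowSq A i) + lam := by
    have h : 0 < 4 * (n : ℝ) * ((⨅ i, rowSq A i) + lam) := hS.trans_le h4
    exact pos_of_mul_pos_right h (by positivity)
  have hmS : (⨅ i, rowSq A i) + lam ≤ frobNorm A ^ 2 + n * lam := by
    have h1 := iInf_rowSq_le A ⟨0, hn⟩
    rw [← sum_rowSq_add]
    refine le_trans (by linarith) (Finset.single_le_sum (f := fun i => rowSq A i + lam)
      (fun i _ => add_nonneg (rowSq_nonneg A i) hl0) (Finset.mem_univ ⟨0, hn⟩))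
  -- Here κ²μ̃ = ‖A‖_F²(σ_min‖A⁻¹‖)²/S, and the bracket is at least 1.
  have hκμ : frobNorm A ^ 2 / (frobNorm A ^ 2 + n * lam) ≤ demmelCond A ^ 2 * arkMu A lam := by
    have h1 := one_le_pow₀ (one_le_sigmaMin_mul_norm_inv hn hA) (n := 2)
    rw [arkMu, ← mul_div_assoc, demmelCond]
    refine div_le_div_of_nonneg_right ?_ hS.le
    have := mul_le_mul_of_nonneg_left h1 (sq_nonneg (frobNorm A))
    linarith
  refine ⟨hm, hS, by unfold arkMu; positivity, ?_, ?_, ?_, ?_, ?_⟩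
  · refine (div_le_one hS).2 ?_
    have := pow_le_pow_left₀ hσ.le (sigmaMin_le_frobNorm hn A) 2
    have : 0 ≤ n * lam := by positivity
    linarith
  · exact (one_le_div hm).2 hmS
  · exact (div_le_iff₀ hm).2 h4
  · have : 1 / 2 ≤ frobNorm A ^ 2 / (frobNorm A ^ 2 + n * lam) := by
      rw [div_le_div_iff₀ two_pos hS]; linarith
    linarith
  · refine le_trans ?_ (mul_le_mul_of_nonneg_left hκμ (by positivity))
    rw [arkNu, ← mul_div_assoc, div_le_div_iff₀ hm hS]
    linarith

theorem mul_norm_invTranspose_sq_le (hn : 1 ≤ n) (hA : IsUnit A)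
    (hS : 0 < frobNorm A ^ 2 + n * lam) (z : EuclideanSpace ℝ (Fin n)) :
    (frobNorm A ^ 2 + n * lam) * ‖invTranspose A z‖ ^ 2 ≤ ‖z‖ ^ 2 / arkMu A lam := by
  have hσ := sigmaMin_pos hn hA
  have h := pow_le_pow_left₀ (by positivity) (sigmaMin_mul_norm_invTranspose_le hA z) 2
  rw [arkMu, div_div_eq_mul_div, le_div_iff₀ (by positivity)]
  nlinarith [mul_le_mul_of_nonneg_left h hS.le]

end Parameters

/-! ### Iterating the recurrence and the final bounds -/

theorem le_geometric_of_recurrence {a : ℕ → ℝ} {ρ δ : ℝ} (hρ : 0 < ρ) (hρ1 : ρ ≤ 1)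
    (hδ : 0 ≤ δ) (h : ∀ k, a (k + 1) ≤ (1 - ρ) * a k + δ) (k : ℕ) :
    a k ≤ (1 - ρ) ^ k * a 0 + δ / ρ := by
  induction k with
  | zero => simpa using by positivity
  | succ k ih =>
    have h1 := mul_le_mul_of_nonneg_left ih (sub_nonneg.2 hρ1)
    have e : (1 - ρ) * (δ / ρ) + δ = δ / ρ := by field_simp; ring
    rw [pow_succ]
    linarith [h k]

theorem one_sub_rpow_le_of_log_le {τ u x : ℝ} (hτ : τ < 1) (hu : 0 < u) (hx : 0 ≤ x)
    (h : Real.log (1 / u) ≤ τ * x) : (1 - τ) ^ x ≤ u := by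
  calc (1 - τ) ^ x ≤ (Real.exp (-τ)) ^ x :=
        Real.rpow_le_rpow (by linarith) (by linarith [Real.add_one_le_exp (-τ)]) hx
    _ = Real.exp (-(τ * x)) := by rw [← Real.exp_mul, neg_mul]
    _ ≤ Real.exp (Real.log u) := by
      rw [one_div, Real.log_inv] at h
      exact Real.exp_le_exp.2 (by linarith)
    _ = u := Real.exp_log hu

section

variable {n : ℕ} {A : Matrix (Fin n) (Fin n) ℝ} {b : Fin n → ℝ} {u lam : ℝ}

/-- The expected error of the computed iterates, in terms of the acceleration parameters. -/
theorem FlArk.integral_norm_le (run : FlArk u A b lam (arkMu A lam) (arkNu A lam))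
    (hn : 1 ≤ n) (hA : IsUnit A)
    (hlam : lam = frobNorm A ^ 2 / n ∨ (lam = 0 ∧ (⨆ i, rowSq A i) ≤ 4 * ⨅ i, rowSq A i))
    (hu : 0 < u) (hnu : n * u ≤ 1 / 1000) {s t ρ ε : ℝ} (hs : s = √(arkMu A lam))
    (ht : t = √(arkNu A lam)) (hρ : ρ = s / t) (hε : ε = 1000 * (n ^ 2 * u) / s)
    (hερ : 40 * ε ^ 2 ≤ ρ ^ 2)
    {xs : EuclideanSpace ℝ (Fin n)} (hxs : ∀ i, A.toEuclideanLin xs i = b i)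
    {Ω : Type*} [MeasurableSpace Ω] (P : Measure Ω) [IsProbabilityMeasure P]
    (r : ℕ → Ω → Fin n) (hr : IsArkSampling A lam P r) (k : ℕ) :
    ∫ ω, ‖run.x (drawn r k ω) - xs‖ ∂P ≤
      3 * (√(2 * (1 - ρ / 2) ^ k + 20 * (ε / ρ) ^ 2) * ‖xs‖) + 120 * (n * u) * ‖xs‖ := by
  obtain ⟨hm, hS0, hμ0, hμ1, hν1, -, -, -⟩ := ark_parameter_bounds hn hA hlam
  obtain ⟨hl0, -, -, -⟩ := ark_regularization hn hA hlam
  have hstar := fun z => mul_norm_invTranspose_sq_le hn hA hS0 z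
  have hmR : ∀ i, (⨅ i, rowSq A i) + lam ≤ rowSq A i + lam := fun i =>
    add_le_add_left (iInf_rowSq_le A i) _
  have hS := (sum_rowSq_add A lam).symm
  have hνS : arkNu A lam = (frobNorm A ^ 2 + n * lam) / ((⨅ i, rowSq A i) + lam) := rfl
  have hFS : frobNorm A ^ 2 ≤ frobNorm A ^ 2 + n * lam := by
    have : 0 ≤ n * lam := by positivity
    linarith
  set S := frobNorm A ^ 2 + n * lam
  set m := (⨅ i, rowSq A i) + lam
  have hs0 : 0 < s := by rw [hs]; exact Real.sqrt_pos.2 hμ0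
  have hs1 : s ≤ 1 := by rw [hs]; exact Real.sqrt_le_one.2 hμ1
  have ht1 : 1 ≤ t := by rw [ht]; exact Real.one_le_sqrt.2 hν1
  have hμ : arkMu A lam = s ^ 2 := by rw [hs, Real.sq_sqrt hμ0.le]
  have hν : arkNu A lam = t ^ 2 := by rw [ht, Real.sq_sqrt (by linarith)]
  have hρ0 : 0 < ρ := by rw [hρ]; positivity
  have hρ1 : ρ ≤ 1 := by rw [hρ]; exact (div_le_one (by linarith)).2 (by linarith)
  set X := ‖xs‖ with hX
  have hX0 : 0 ≤ X := norm_nonneg _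
  set L : List (Fin n) → ℝ := fun h => arkLyapunov A S (arkMu A lam) (run.v h - xs) (run.y h - xs) with hL
  have hL0 : ∀ h, 0 ≤ L h := fun h => arkLyapunov_nonneg hS0.le hμ0.le _ _
  have hp : ∀ i, 0 ≤ (rowSq A i + lam) / S := fun i => div_nonneg (hm.trans_le (hmR i)).le hS0.le
  have hLint := hr.integrable_comp_drawn L
  have hrec : ∀ k, ∫ ω, L (drawn r (k + 1) ω) ∂P ≤
      (1 - ρ / 2) * ∫ ω, L (drawn r k ω) ∂P + 10 * ε ^ 2 / ρ * (X / s) ^ 2 := by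
    intro k
    have hrhs : ∫ ω, ((1 - ρ / 2) * L (drawn r k ω) + 10 * ε ^ 2 / ρ * (X / s) ^ 2) ∂P =
        (1 - ρ / 2) * ∫ ω, L (drawn r k ω) ∂P + 10 * ε ^ 2 / ρ * (X / s) ^ 2 := by
      rw [integral_add ((hLint k).const_mul _) (integrable_const _), integral_const_mul,
        integral_const, probReal_univ, one_smul]
    rw [hr.integral_drawn_succ hS hp, ← hrhs]
    refine integral_mono
      (hr.integrable_comp_drawn (fun h => ∑ i, (rowSq A i + lam) / S * L (i :: h)) k)
      (((hLint k).const_mul _).add (integrable_const _)) fun ω => ?_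
    have := run.sum_lyapunov_le hA hn hu hnu hs0 hs1 ht1 hμ hν hl0 hm hmR hS hFS hS0 hνS hstar hxs
      hε (by rwa [← hρ]) (drawn r k ω)
    rwa [← hρ] at this
  have hbase : ∫ ω, L (drawn r 0 ω) ∂P ≤ 2 * (X / s) ^ 2 := by
    have h1 : L [] ≤ 2 * (X / s) ^ 2 := by
      rw [hL]
      simp only [run.v_nil, run.y_nil, zero_sub]
      refine (arkLyapunov_le_of_norm_le (a := X) (c := X) hμ0 hstar (norm_neg _).le
        (norm_neg _).le).trans (le_of_eq ?_)
      rw [hμ]; ring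
    simpa [drawn] using h1
  have hgeo := le_geometric_of_recurrence (a := fun k => ∫ ω, L (drawn r k ω) ∂P) (ρ := ρ / 2)
    (by linarith) (by linarith) (by positivity) hrec k
  have hLk : ∫ ω, L (drawn r k ω) ∂P ≤
      (2 * (1 - ρ / 2) ^ k + 20 * (ε / ρ) ^ 2) * (X / s) ^ 2 := by
    have h1 := mul_le_mul_of_nonneg_left hbase
      (pow_nonneg (by linarith : 0 ≤ 1 - ρ / 2) k)
    have e : 10 * ε ^ 2 / ρ * (X / s) ^ 2 / (ρ / 2) = 20 * (ε / ρ) ^ 2 * (X / s) ^ 2 := by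
      field_simp; ring
    rw [e] at hgeo
    linarith
  have hsqrt : ∫ ω, √(L (drawn r k ω)) ∂P ≤
      √(2 * (1 - ρ / 2) ^ k + 20 * (ε / ρ) ^ 2) * (X / s) := by
    -- Jensen's inequality for the concave square root.
    have h1 := Real.strictConcaveOn_sqrt.concaveOn.le_map_integral (μ := P)
      (f := fun ω => L (drawn r k ω)) Real.continuous_sqrt.continuousOn isClosed_Ici
      (Filter.Eventually.of_forall fun ω => hL0 _) (hLint k)
      (hr.integrable_comp_drawn (fun h => √(L h)) k)
    refine h1.trans ((Real.sqrt_le_sqrt hLk).trans (le_of_eq ?_))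
    rw [Real.sqrt_mul' _ (by positivity), Real.sqrt_sq (by positivity)]
  -- The factor `s` gained here cancels the 1/s in the initial size ‖x‖/s of √Φ.
  have hx : ∀ h, ‖run.x h - xs‖ ≤ 3 * s * √(L h) + 120 * (n * u) * X := by
    intro h
    have hv : ‖run.v h - xs‖ ≤ √(L h) :=
      Real.le_sqrt_of_sq_le (norm_sq_le_arkLyapunov hA hFS hμ0 _ _)
    have hy : ‖run.y h - xs‖ ≤ s * √(L h) := by
      have := Real.le_sqrt_of_sq_le
        (norm_sq_le_mul_arkLyapunov (A := A) hS0.le hμ0 (run.v h - xs) (run.y h - xs))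
      rwa [Real.sqrt_mul hμ0.le, ← hs] at this
    have h1 := (run.step_perturbation hn hu hnu hs0 hs1 ht1 hμ hν hl0
      (fun i => hm.trans_le (hmR i)) hxs (M := √(L h) + X / s) h hv hy
      (by rw [← hX]; field_simp) rfl).1
    have e : s * (√(L h) + X / s) = s * √(L h) + X := by field_simp
    rw [e] at h1
    have h2 : 0 ≤ s * √(L h) := by positivity
    have h3 := mul_le_mul_of_nonneg_right hnu h2
    linarith
  calc ∫ ω, ‖run.x (drawn r k ω) - xs‖ ∂P
      ≤ ∫ ω, (3 * s * √(L (drawn r k ω)) + 120 * (n * u) * X) ∂P :=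
        integral_mono (hr.integrable_comp_drawn (fun h => ‖run.x h - xs‖) k)
          (((hr.integrable_comp_drawn (fun h => √(L h)) k).const_mul _).add (integrable_const _))
          fun ω => hx _
    _ = 3 * s * ∫ ω, √(L (drawn r k ω)) ∂P + 120 * (n * u) * X := by
      rw [integral_add ((hr.integrable_comp_drawn (fun h => √(L h)) k).const_mul _)
        (integrable_const _), integral_const_mul, integral_const, probReal_univ, one_smul]
    _ ≤ 3 * s * (√(2 * (1 - ρ / 2) ^ k + 20 * (ε / ρ) ^ 2) * (X / s)) + 120 * (n * u) * X := by
      gcongr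
    _ = _ := by
      have hsX : s * (X / s) = X := by field_simp
      linear_combination (3 * √(2 * (1 - ρ / 2) ^ k + 20 * (ε / ρ) ^ 2)) * hsX

theorem FlArk.integral_norm_le_demmelCond
    (run : FlArk u A b lam (arkMu A lam) (arkNu A lam)) (hn : 1 ≤ n) (hA : IsUnit A)
    (hlam : lam = frobNorm A ^ 2 / n ∨ (lam = 0 ∧ (⨆ i, rowSq A i) ≤ 4 * ⨅ i, rowSq A i))
    (hu : 0 < u) (hκu : 10 ^ 5 * ((n : ℝ) + 1) ^ 3 * (demmelCond A ^ 2 * u) ≤ 1)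
    {xs : EuclideanSpace ℝ (Fin n)} (hxs : ∀ i, A.toEuclideanLin xs i = b i)
    {Ω : Type*} [MeasurableSpace Ω] (P : Measure Ω) [IsProbabilityMeasure P]
    (r : ℕ → Ω → Fin n) (hr : IsArkSampling A lam P r) (k : ℕ) :
    ∫ ω, ‖run.x (drawn r k ω) - xs‖ ∂P ≤
      (1 - 1 / (4 * demmelCond A * √n)) ^ ((k : ℝ) / 4) * (6 * ‖xs‖)
        + 10 ^ 5 * ((n : ℝ) + 1) ^ 3 * ‖xs‖ * (demmelCond A ^ 2 * u) := by
  obtain ⟨-, -, hμ0, hμ1, hν1, hν4, hκμ, hνκ⟩ := ark_parameter_bounds hn hA hlam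
  have hκ := one_le_demmelCond hn hA
  have hn' : (1 : ℝ) ≤ n := by exact_mod_cast hn
  have key := run.integral_norm_le hn hA hlam hu (hs := rfl) (ht := rfl) (hρ := rfl) (hε := rfl)
    (hxs := hxs) (P := P) (r := r) (hr := hr) (k := k)
  set κ := demmelCond A
  set s := √(arkMu A lam)
  set t := √(arkNu A lam)
  have hs0 : 0 < s := Real.sqrt_pos.2 hμ0
  have hs1 : s ≤ 1 := Real.sqrt_le_one.2 hμ1
  have ht1 : 1 ≤ t := Real.one_le_sqrt.2 hν1
  have hs2 : s ^ 2 = arkMu A lam := Real.sq_sqrt hμ0.le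
  have ht2 : t ^ 2 = arkNu A lam := Real.sq_sqrt (by linarith)
  rw [← hs2] at hκμ hνκ
  rw [← ht2] at hν4 hνκ
  have ht0 : 0 < t := by linarith
  set N := ((n : ℝ) + 1) ^ 3 with hN
  have hnN : (n : ℝ) ^ 3 ≤ N := pow_le_pow_left₀ (by linarith) (by linarith) 3
  have hn1N : (n : ℝ) ≤ N := by
    have : (n : ℝ) ≤ n ^ 3 := le_self_pow₀ hn' (by norm_num)
    linarith
  have hu_le : u ≤ κ ^ 2 * u := le_mul_of_one_le_left hu.le (one_le_pow₀ hκ)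
  have hκu0 : 0 ≤ κ ^ 2 * u := by positivity
  have hNu : (n : ℝ) * u ≤ N * (κ ^ 2 * u) := by gcongr
  have ht2n : t ≤ 2 * n := by
    refine le_of_sq_le_sq (b := 2 * (n : ℝ)) ?_ (by positivity)
    nlinarith
  set δ := 1000 * (n ^ 2 * u) / s / (s / t) with hδ
  have hδ0 : 0 ≤ δ := by positivity
  -- δ is ε/ρ = 1000n²ut/s². The factor n³κ² arises from t ≤ 2n and 1 ≤ 2κ²s².
  have hδN : δ ≤ 4000 * (N * (κ ^ 2 * u)) := by
    have e : δ = 1000 * (n ^ 2 * u) * t / s ^ 2 := by rw [hδ]; field_simp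
    rw [e, div_le_iff₀ (by positivity)]
    calc 1000 * (n ^ 2 * u) * t ≤ 1000 * (n ^ 2 * u) * (2 * n) * (2 * (κ ^ 2 * s ^ 2)) := by
          rw [← mul_one (1000 * (n ^ 2 * u) * t)]; gcongr
      _ = 4000 * (n ^ 3 * (κ ^ 2 * u)) * s ^ 2 := by ring
      _ ≤ _ := by gcongr
  specialize key (by linarith) (by
    have h1 : 1000 * (n ^ 2 * u) / s = δ * (s / t) := by rw [hδ]; field_simp
    rw [h1, mul_pow, ← mul_assoc]
    refine mul_le_of_le_one_left (sq_nonneg _) ?_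
    have h2 : δ ≤ 1 / 10 := by linarith
    nlinarith)
  refine key.trans ?_
  have hsn : 0 < √(n : ℝ) := Real.sqrt_pos.2 (by linarith)
  have hsn1 : 1 ≤ √(n : ℝ) := Real.one_le_sqrt.2 hn'
  have hκn : 1 ≤ κ * √n := by nlinarith
  -- This is ν̃ ≤ 4nκ²μ̃ after taking roots.
  have hrate : 1 / (2 * (κ * √n)) ≤ s / t := by
    rw [div_le_div_iff₀ (by positivity) ht0, one_mul]
    refine le_of_sq_le_sq (b := s * (2 * (κ * √n))) ?_ (by positivity)
    rw [mul_pow, mul_pow, mul_pow, Real.sq_sqrt (by linarith : (0 : ℝ) ≤ n)]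
    linarith
  have hst1 : s / t ≤ 1 := (div_le_one ht0).2 (by linarith)
  set τ := 1 / (4 * κ * √n) with hτ
  have hτ' : τ ≤ s / t / 2 := by
    have : τ = 1 / (2 * (κ * √n)) / 2 := by rw [hτ]; field_simp; norm_num
    linarith
  have hτ0 : 0 < τ := by positivity
  set E := (1 - τ) ^ ((k : ℝ) / 4) with hE
  have h1τ : 0 < 1 - τ := by linarith
  have hE0 : 0 ≤ E := Real.rpow_nonneg h1τ.le _
  have hE1 : E ≤ 1 := Real.rpow_le_one h1τ.le (by linarith) (by positivity)
  -- The exponent k/4 leaves slack: the power is bounded by E⁴, while E² is enough under the square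
  -- root.
  have hE4 : (1 - s / t / 2) ^ k ≤ E ^ 2 := by
    have h1 : (1 - s / t / 2) ^ k ≤ (1 - τ) ^ k :=
      pow_le_pow_left₀ (by linarith) (by linarith) k
    have h2 : (1 - τ) ^ k = E ^ 4 := by
      rw [hE, ← Real.rpow_natCast (_ ^ _) 4, ← Real.rpow_mul h1τ.le, ← Real.rpow_natCast]
      congr 1; push_cast; ring
    exact (h1.trans h2.le).trans (pow_le_pow_of_le_one hE0 hE1 (by norm_num))
  have hroot : √(2 * (1 - s / t / 2) ^ k + 20 * δ ^ 2) ≤ 2 * E + 5 * δ := by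
    refine Real.sqrt_le_iff.2 ⟨by positivity, ?_⟩
    nlinarith [mul_nonneg hE0 hδ0, sq_nonneg δ, sq_nonneg E]
  have hX := norm_nonneg xs
  have h1 := mul_le_mul_of_nonneg_right hroot hX
  have h2 := mul_le_mul_of_nonneg_right hδN hX
  have h3 := mul_le_mul_of_nonneg_right hNu hX
  have h4 : 0 ≤ N * (κ ^ 2 * u) * ‖xs‖ := by positivity
  -- The coefficients add up to 3·5·4000 + 120 ≤ 10⁵, and 3·2 = 6 gives the constant `c`.
  linarith

end

theorem theorem4p2 :
    ∃ (c K : ℝ) (C C₁ D : Polynomial ℝ), 0 < c ∧ 0 < K ∧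
      (∀ m : ℕ, 0 < C.eval (m : ℝ) ∧ 0 < C₁.eval (m : ℝ) ∧ 0 < D.eval (m : ℝ)) ∧
      ∀ (n : ℕ), 1 ≤ n →
      ∀ (A : Matrix (Fin n) (Fin n) ℝ), IsUnit A →
      ∀ (b : Fin n → ℝ) (x : EuclideanSpace ℝ (Fin n)), x = WithLp.toLp 2 (A⁻¹ *ᵥ b) →
      ∀ (lam : ℝ),
        (lam = frobNorm A ^ 2 / n ∨
          (lam = 0 ∧ (⨆ i, rowSq A i) ≤ 4 * ⨅ i, rowSq A i)) →
      ∀ (u : ℝ), 0 < u → demmelCond A ^ 2 * u ≤ 1 / D.eval (n : ℝ) →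
      ∀ (run : FlArk u A b lam (arkMu A lam) (arkNu A lam))
        (Ω : Type*) [MeasurableSpace Ω] (P : Measure Ω) [IsProbabilityMeasure P]
        (r : ℕ → Ω → Fin n), IsArkSampling A lam P r →
        (∀ k : ℕ, Integrable (fun ω => ‖run.x (drawn r k ω) - x‖) P) ∧
        (∀ k : ℕ, ∫ ω, ‖run.x (drawn r k ω) - x‖ ∂P ≤
          (1 - 1 / (4 * demmelCond A * Real.sqrt n)) ^ ((k : ℝ) / 4) * (c * ‖x‖)
            + C.eval (n : ℝ) * ‖x‖ * (demmelCond A ^ 2 * u)) ∧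
        (∀ k : ℕ, K * (demmelCond A * Real.sqrt n * Real.log (1 / u)) ≤ (k : ℝ) →
          ∫ ω, ‖run.x (drawn r k ω) - x‖ ∂P ≤
            C₁.eval (n : ℝ) * ‖x‖ * (demmelCond A ^ 2 * u)) := by
  open Polynomial in
  -- `K = 16` makes τ·(k/4) = k/(16κ√n) at least log(1/u) for τ = 1/(4κ√n). The decaying term is
  -- then at most 6u‖x‖, which is absorbed by the extra 6 in `C₁` because u ≤ κ²u.
  refine ⟨6, 16, Polynomial.C (10 ^ 5) * (X + 1) ^ 3, Polynomial.C (10 ^ 5) * (X + 1) ^ 3 + 6,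
    Polynomial.C (10 ^ 5) * (X + 1) ^ 3, by norm_num, by norm_num, fun m => ?_, ?_⟩
  · have : (0 : ℝ) < 10 ^ 5 * ((m : ℝ) + 1) ^ 3 := by positivity
    have h6 : (6 : ℝ[X]).eval (m : ℝ) = 6 := Polynomial.eval_ofNat 6 _
    simp only [eval_mul, eval_C, eval_pow, eval_add, eval_X, eval_one, h6]
    exact ⟨this, by linarith, this⟩
  intro n hn A hA b x hx lam hlam u hu hκu run Ω _ P _ r hr
  have h6 : (6 : ℝ[X]).eval (n : ℝ) = 6 := Polynomial.eval_ofNat 6 _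
  simp only [eval_mul, eval_C, eval_pow, eval_add, eval_X, eval_one, h6] at hκu ⊢
  have hκ := one_le_demmelCond hn hA
  have hn' : (1 : ℝ) ≤ n := by exact_mod_cast hn
  rw [le_div_iff₀' (by positivity)] at hκu
  have hxs : ∀ i, A.toEuclideanLin x i = b i := fun i => by
    have h := toEuclideanLin_inv_apply hA (WithLp.toLp 2 b)
    have hx' : x = A⁻¹.toEuclideanLin (WithLp.toLp 2 b) := by rw [hx]; rfl
    rw [hx', h]
  have hmain := run.integral_norm_le_demmelCond hn hA hlam hu hκu hxs P r hr
  refine ⟨hr.integrable_comp_drawn fun h => ‖run.x h - x‖, hmain, fun k hk => ?_⟩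
  have hsn : 1 ≤ √(n : ℝ) := Real.one_le_sqrt.2 hn'
  have hκn : 1 ≤ demmelCond A * √n := by nlinarith
  have hdecay : (1 - 1 / (4 * demmelCond A * √n)) ^ ((k : ℝ) / 4) ≤ u := by
    refine one_sub_rpow_le_of_log_le ?_ hu (by positivity) ?_
    · rw [div_lt_one (by positivity)]; linarith
    · have e : 1 / (4 * demmelCond A * √n) * ((k : ℝ) / 4) = k / (16 * (demmelCond A * √n)) := by
        field_simp; ring
      rw [e, le_div_iff₀ (by positivity)]
      linarith
  have hu_le : u ≤ demmelCond A ^ 2 * u := le_mul_of_one_le_left hu.le (one_le_pow₀ hκ)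
  have h1 := mul_le_mul_of_nonneg_right (hdecay.trans hu_le)
    (by positivity : 0 ≤ 6 * ‖x‖)
  linarith [hmain k]
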